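/- For $d\ge 3$ let $T_d$ be the infinite $d$-regular tree. Let $p\ge 1$, let $3\le d_1<d_2<\dots<d_p$ be integers and let $k_1,\dots,k_p$ be positive integers. Let $X=\prod_{i=1}^{p}T_{d_i}^{k_i}$ be the Cartesian product graph with $k_i$ factors $T_{d_i}$ for each $i$ (two vertices are adjacent if and only if they differ in exactly one coordinate and are adjacent there). Fix an arbitrary vertex $v^*$ of $X$. For an integer $r\ge 1$ let $G_r$ be the subgraph of $X$ induced by the (finite) closed ball $B(v^*,r)$ of radius $r$ in the graph distance of $X$, and let $n=n(r)=|B(v^*,r)|$. Each unordered pair of distinct vertices of $G_r$ exchanges a unit flow, which is split equally among all geodesics (shortest paths) in $G_r$ between the two vertices. Let $\mathcal L_r(v^*)$ be the total flow passing through $v^*$, the end points of a geodesic being counted as points that it passes through. Then $$\mathcal L_r(v^*)=\Theta\!\left(\frac{n^2}{\bigl(\log_{d_p-1} n\bigr)^{k_p-1}}\right)\quad\text{as } r \text{ increases},$$ that is, there are constants $c_1,c_2>0$, depending only on $p$, $(d_i)$ and $(k_i)$, such that for all $r\ge 1$ $$c_1\,\frac{n^2}{\bigl(\log_{d_p-1}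 n\bigr)^{k_p-1}}\;\le\;\mathcal L_r(v^*)\;\le\; c_2\,\frac{n^2}{\bigl(\log_{d_p-1} n\bigr)^{k_p-1}} .$$ -/

import Mathlib

/-- The (Cartesian) product of a family of graphs: two vertices are adjacent when they differ in
exactly one coordinate, and are adjacent in that coordinate. -/
def boxProdPi {ι : Type*} {V : ι → Type*} (G : (i : ι) → SimpleGraph (V i)) :
    SimpleGraph ((i : ι) → V i) where
  Adj x y := ∃ i, (G i).Adj (x i) (y i) ∧ ∀ j, j ≠ i → x j = y j
  symm := ⟨fun _ _ ⟨i, h, hj⟩ => ⟨i, h.symm, fun j hji => (hj j hji).symm⟩⟩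
  loopless := ⟨fun _ ⟨_, h, _⟩ => h.ne rfl⟩

/-- The product `∏ i, (T i) ^ (k i)`: one coordinate in `T i` for each `i` and each `j < k i`. -/
abbrev prodPow {p : ℕ} {V : Fin p → Type*} (T : (i : Fin p) → SimpleGraph (V i)) (k : Fin p → ℕ) :
    SimpleGraph ((s : (i : Fin p) × Fin (k i)) → V s.1) :=
  boxProdPi fun s : (i : Fin p) × Fin (k i) => T s.1

/-- The closed ball `B(v, r)` of radius `r` around `v` in the graph distance. -/
def graphBall {V : Type*} (G : SimpleGraph V) (v : V) (r : ℕ) : Set V :=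
  {x | G.edist v x ≤ r}

/-- The centre of a ball, as a vertex of the ball. -/
def graphBallCenter {V : Type*} (G : SimpleGraph V) (v : V) (r : ℕ) : graphBall G v r :=
  ⟨v, by simp [graphBall]⟩

/-- The geodesics from `u` to `w`: the walks of minimal length. -/
def geodesics {V : Type*} (G : SimpleGraph V) (u w : V) : Set (G.Walk u w) :=
  {q | q.length = G.dist u w}

/-- The part of a unit flow between `u` and `w`, split equally among all geodesics from `u` to `w`,
that passes through `v` (end points count as passed). -/
noncomputable def flowThrough {V : Type*} (G : SimpleGraph V) (u w v : V) : ℝ :=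
  ({q ∈ geodesics G u w | v ∈ q.support}.ncard : ℝ) / ((geodesics G u w).ncard : ℝ)

/-- The traffic load at `v` in a finite graph: the sum of the flows through `v` over all unordered
pairs of distinct vertices. The sum below runs over the ordered pairs, whence the factor `1/2`. -/
noncomputable def trafficLoad {V : Type*} (G : SimpleGraph V) (v : V) : ℝ :=
  (1 / 2) * ∑ᶠ e ∈ {e : V × V | e.1 ≠ e.2}, flowThrough G e.1 e.2 v

/-!
Let `q s + 1` be the degree of the factor `T s`, let `Q` be the largest of the `q s`, attained `k`
times, and let `ρ s = q s / Q`. A vertex of the ball is described, up to symmetry, by the vector `a`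
of the distances of its coordinates from those of the centre `v`; there are about
`Q ^ |a| * ρ ^ a` vertices for each vector. Hence the ball of radius `r` has about
`Q ^ r * h_r(ρ)` vertices, where `h_n` is the complete homogeneous symmetric polynomial, and
`h_n(ρ)` is of order `n ^ (k - 1)` (`exists_completeHomogeneous_le`,
`exists_le_completeHomogeneous`). So `log_Q n` is of order `r`, and the claim is that the load is of
order `Q ^ (2 * r) * r ^ (k - 1)`.

A geodesic of the ball between `u` and `w` passes through `v` only if in every coordinate `v` lies
between `u` and `w` (`flowThrough_eq_zero_of_not_between`). In that case geodesics are words that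
tell in which coordinate the next step is taken (`ncard_walksWithin`). If `a` and `b` are the
distance vectors of `u` and `w`, and `M` denotes multinomial coefficients, the flow through `v` is
`M(a) * M(b) / N`, where `N` counts the words whose geodesic stays in the ball.

For the lower bound `N ≤ M(a + b)` is enough: by Vandermonde's identity, summing
`ρ ^ (a + b) * M(a) * M(b) / M(a + b)` over all `a` and `b` of size `r` gives exactly `h_{2r}(ρ)`
(`sum_monomialAt_splitRatio`).

For the upper bound, geodesics are counted that descend from `u` half way to `v`, then move freely,
and then ascend to `w`. Their middle part starts and ends at height at most `r / 2` and has length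
at most `r`, so they stay in the ball; hence `N` is at least the sum of
`M(a - a') * M(a' + b') * M(b - b')` over the halves `a'` of `a` and `b'` of `b`
(`sum_le_latticePaths`). As `M(a) * M(b)` is the sum of `M(a - a') * M(a') * M(b') * M(b - b')` over
the same halves, the Cauchy-Schwarz inequality bounds the flow by the average of
`M(a') * M(b') / M(a' + b')` over randomly chosen halves (`div_le_halvesAverage`). A given vector
`a'` is the half of only boundedly many vectors `a`, counted with probability (`sum_hypergeom_le`),
so Vandermonde's identity applies to the halves and bounds the weighted sum of all flows by a
constant times some `h_n(ρ)` with `n ≤ r` (`sum_monomialAt_halvesAverage_le`).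
-/

open Finset

/-! ### Lattice paths and multinomial coefficients -/

/-- The number of words with exactly `a s` letters `s`. -/
noncomputable def wordCount {S : Type*} [Fintype S] (a : S → ℕ) : ℕ :=
  Nat.multinomial univ a

open scoped Classical in
/-- The number of sequences of `n` unit steps in `ℕ ^ S`, each raising one coordinate by one, that
lead from `x` to `y` and all of whose points (both ends included) satisfy `ok`. -/
noncomputable def latticePaths {S : Type*} [Fintype S] [DecidableEq S] (ok : (S → ℕ) → Prop)
    (y : S → ℕ) : ℕ → (S → ℕ) → ℕ
  | 0, x => if x = y ∧ ok x then 1 else 0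
  | n + 1, x => if ok x then ∑ s, latticePaths ok y n (x + Pi.single s 1) else 0

/-- The vectors below `c` with coordinate sum `m`. -/
def subVectors {S : Type*} [Fintype S] [DecidableEq S] (c : S → ℕ) (m : ℕ) : Finset (S → ℕ) :=
  {z ∈ Iic c | ∑ s, z s = m}

section Lattice

variable {S : Type*} [Fintype S]

lemma wordCount_pos (a : S → ℕ) : 0 < wordCount a := Nat.multinomial_pos _ _

lemma prod_factorial_mul_wordCount (a : S → ℕ) :
    (∏ s, (a s).factorial) * wordCount a = (∑ s, a s).factorial :=
  Nat.multinomial_spec _ _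

lemma sum_sub_eq {x y : S → ℕ} (h : x ≤ y) : ∑ s, (y - x) s = ∑ s, y s - ∑ s, x s := by
  have : ∑ s, (y - x) s + ∑ s, x s = ∑ s, y s := by
    rw [← sum_add_distrib]
    exact sum_congr rfl fun s _ => Nat.sub_add_cancel (h s)
  omega

lemma eq_of_le_of_sum_eq {x y : S → ℕ} (h : x ≤ y) (hs : ∑ s, x s = ∑ s, y s) : x = y := by
  funext s
  exact (sum_eq_sum_iff_of_le fun i _ => h i).1 hs s (mem_univ s)

lemma wordCount_zero : wordCount (0 : S → ℕ) = 1 := by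
  have := prod_factorial_mul_wordCount (0 : S → ℕ)
  simpa using this

variable [DecidableEq S]

lemma sum_add_single (x : S → ℕ) (s : S) :
    ∑ i, (x + Pi.single s 1 : S → ℕ) i = ∑ i, x i + 1 := by
  simp [sum_add_distrib]

/-- The first-letter recursion for words with prescribed letter counts. -/
lemma wordCount_eq_sum {n : ℕ} (a : S → ℕ) (ha : ∑ s, a s = n + 1) :
    wordCount a = ∑ s, if 0 < a s then wordCount (a - Pi.single s 1) else 0 := by
  have hpos : 0 < ∏ s, (a s).factorial := prod_pos fun s _ => Nat.factorial_pos _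
  apply Nat.eq_of_mul_eq_mul_left hpos
  rw [prod_factorial_mul_wordCount, ha, Nat.factorial_succ, ← ha, sum_mul, mul_sum]
  refine sum_congr rfl fun s _ => ?_
  split_ifs with h
  · have hle : (Pi.single s 1 : S → ℕ) ≤ a := by
      intro i
      by_cases hi : i = s
      · subst hi; simpa using Nat.succ_le_of_lt h
      · simp [hi]
    have h1 : ∑ i, (a - Pi.single s 1 : S → ℕ) i = n := by
      rw [sum_sub_eq hle, ha]; simp
    have h2 := prod_factorial_mul_wordCount (a - Pi.single s 1)
    rw [h1] at h2
    rw [← h2, ← mul_assoc]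
    congr 1
    rw [← mul_prod_erase univ _ (mem_univ s),
      ← mul_prod_erase univ (fun i => (a i).factorial) (mem_univ s), ← mul_assoc]
    congr 1
    · simp [Nat.mul_factorial_pred h.ne']
    · refine prod_congr rfl fun i hi => ?_
      simp [(mem_erase.1 hi).1]
  · have : a s = 0 := by omega
    simp [this]

lemma latticePaths_ne_zero {ok : (S → ℕ) → Prop} {y : S → ℕ} {n : ℕ} {x : S → ℕ}
    (h : latticePaths ok y n x ≠ 0) : x ≤ y ∧ ∑ s, x s + n = ∑ s, y s := by
  induction n generalizing x with
  | zero =>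
    simp only [latticePaths] at h
    split_ifs at h with h'
    · simp [h'.1]
    · exact absurd rfl h
  | succ n ih =>
    simp only [latticePaths] at h
    split_ifs at h with h'
    · obtain ⟨s, -, hs⟩ := exists_ne_zero_of_sum_ne_zero h
      obtain ⟨h1, h2⟩ := ih hs
      refine ⟨le_trans (fun i => ?_) h1, ?_⟩
      · simp
      · rw [sum_add_single] at h2; omega
    · exact absurd rfl h

lemma latticePaths_mono {ok ok' : (S → ℕ) → Prop} {y : S → ℕ} {n : ℕ} {x : S → ℕ}
    (h : ∀ z, x ≤ z → z ≤ y → ok z → ok' z) :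
    latticePaths ok y n x ≤ latticePaths ok' y n x := by
  induction n generalizing x with
  | zero =>
    simp only [latticePaths]
    split_ifs with h1 h2
    · rfl
    · exact absurd ⟨h1.1, h x le_rfl h1.1.le h1.2⟩ h2
    · simp
    · rfl
  | succ n ih =>
    by_cases h0 : latticePaths ok y (n + 1) x = 0
    · simp [h0]
    have hxy := (latticePaths_ne_zero h0).1
    simp only [latticePaths] at h0 ⊢
    split_ifs at h0 ⊢ with h1 h2
    · refine sum_le_sum fun s _ => ih fun z hz hzy => h z (le_trans (fun i => ?_) hz) hzy
      simp
    · exact absurd (h x le_rfl hxy h1) h2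
    all_goals simp_all

/-- Splitting paths at the point they reach after `m` steps. -/
lemma latticePaths_split (ok : (S → ℕ) → Prop) (y : S → ℕ) (m n : ℕ) (x : S → ℕ) :
    latticePaths ok y (m + n) x =
      ∑ z ∈ piAntidiag univ (∑ s, x s + m), latticePaths ok z m x * latticePaths ok y n z := by
  induction m generalizing x with
  | zero =>
    rw [sum_eq_single x]
    · simp only [zero_add, latticePaths, true_and]
      by_cases h : ok x
      · simp [h]
      · cases n <;> simp [latticePaths, h]
    · intro z _ hz
      simp [latticePaths, hz.symm]
    · simp
  | succ m ih =>
    rw [show m + 1 + n = (m + n) + 1 by ring]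
    simp only [latticePaths]
    split_ifs with h
    · simp_rw [sum_mul]
      rw [sum_comm]
      refine sum_congr rfl fun s _ => ?_
      rw [ih, sum_add_single]
      congr 2
      ring
    · simp

lemma latticePaths_eq_wordCount {ok : (S → ℕ) → Prop} {y : S → ℕ} {n : ℕ} {x : S → ℕ}
    (hok : ∀ z, x ≤ z → z ≤ y → ok z) (hxy : x ≤ y) (hn : ∑ s, x s + n = ∑ s, y s) :
    latticePaths ok y n x = wordCount (y - x) := by
  induction n generalizing x with
  | zero =>
    have := eq_of_le_of_sum_eq hxy hn
    subst this
    simp [latticePaths, hok x le_rfl le_rfl, wordCount_zero]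
  | succ n ih =>
    rw [wordCount_eq_sum (n := n) _ (by rw [sum_sub_eq hxy]; omega)]
    simp only [latticePaths, if_pos (hok x le_rfl hxy)]
    refine sum_congr rfl fun s _ => ?_
    have hx : x ≤ x + Pi.single s 1 := fun i => by simp
    split_ifs with h
    · have hle : x + Pi.single s 1 ≤ y := by
        intro i
        by_cases hi : i = s
        · subst hi
          simp only [Pi.sub_apply] at h
          simp only [Pi.add_apply, Pi.single_eq_same]; omega
        · simpa [hi] using hxy i
      rw [ih (fun z hz => hok z (hx.trans hz)) hle (by rw [sum_add_single]; omega)]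
      congr 1
      funext i
      simp only [Pi.sub_apply, Pi.add_apply]; omega
    · by_contra h0
      have := (latticePaths_ne_zero h0).1 s
      simp at this h
      omega

lemma latticePaths_le_wordCount {ok : (S → ℕ) → Prop} {y : S → ℕ} {n : ℕ} {x : S → ℕ}
    (hxy : x ≤ y) (hn : ∑ s, x s + n = ∑ s, y s) :
    latticePaths ok y n x ≤ wordCount (y - x) := by
  rw [← latticePaths_eq_wordCount (ok := fun _ => True) (fun _ _ _ => trivial) hxy hn]
  exact latticePaths_mono fun _ _ _ _ => trivial

lemma mem_subVectors {c z : S → ℕ} {m : ℕ} :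
    z ∈ subVectors c m ↔ z ≤ c ∧ ∑ s, z s = m := by
  simp [subVectors]

lemma mem_piAntidiag_univ {z : S → ℕ} {m : ℕ} :
    z ∈ piAntidiag univ m ↔ ∑ s, z s = m := by
  simp

lemma subVectors_subset (c : S → ℕ) (m : ℕ) :
    subVectors c m ⊆ piAntidiag univ m := fun _ hz =>
  mem_piAntidiag_univ.2 (mem_subVectors.1 hz).2

/-- Splitting a word after its first `m` letters: the multivariate Vandermonde identity. -/
lemma wordCount_split (c : S → ℕ) {m : ℕ} (hm : m ≤ ∑ s, c s) :
    wordCount c = ∑ z ∈ subVectors c m, wordCount z * wordCount (c - z) := by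
  have h := latticePaths_split (fun _ => True) c m (∑ s, c s - m) 0
  rw [latticePaths_eq_wordCount (fun _ _ _ => trivial) (zero_le)
    (by simp; omega)] at h
  simp only [Pi.zero_apply, sum_const_zero, zero_add, tsub_zero] at h
  rw [h]
  symm
  refine sum_subset_zero_on_sdiff (subVectors_subset c m) ?_ ?_
  · intro z hz
    rw [mem_sdiff, mem_piAntidiag_univ, mem_subVectors] at hz
    rw [mul_eq_zero]
    right
    by_contra h0
    exact hz.2 ⟨(latticePaths_ne_zero h0).1, hz.1⟩
  · intro z hz
    obtain ⟨hzc, hz⟩ := mem_subVectors.1 hz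
    rw [latticePaths_eq_wordCount (fun _ _ _ => trivial) (zero_le) (by simp [hz]),
      latticePaths_eq_wordCount (fun _ _ _ => trivial) hzc (by omega), tsub_zero]

/-- Replacing a summation over vectors below `a` by one over their differences from `a`. -/
lemma sum_subVectors_sub {M : Type*} [AddCommMonoid M] (a : S → ℕ) {i : ℕ}
    (hi : i ≤ ∑ s, a s) (f : (S → ℕ) → M) :
    ∑ z ∈ subVectors a (∑ s, a s - i), f z = ∑ z ∈ subVectors a i, f (a - z) := by
  refine sum_nbij' (fun z => a - z) (fun z => a - z) ?_ ?_ ?_ ?_ ?_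
  · intro z hz
    rw [mem_subVectors] at hz ⊢
    refine ⟨tsub_le_self, ?_⟩
    rw [sum_sub_eq hz.1, hz.2]; omega
  · intro z hz
    rw [mem_subVectors] at hz ⊢
    refine ⟨tsub_le_self, ?_⟩
    rw [sum_sub_eq hz.1, hz.2]
  · intro z hz
    exact tsub_tsub_cancel_of_le (mem_subVectors.1 hz).1
  · intro z hz
    exact tsub_tsub_cancel_of_le (mem_subVectors.1 hz).1
  · intro z hz
    rw [tsub_tsub_cancel_of_le (mem_subVectors.1 hz).1]

end Lattice

/-! ### Sums over compositions -/

/-- The probability that a uniformly chosen `∑ s, z s`-element subset of a set which consists of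
`a s` elements of each colour `s` has exactly `z s` elements of each colour `s`. -/
noncomputable def hypergeom {S : Type*} [Fintype S] (a z : S → ℕ) : ℝ :=
  (∏ s, ((a s).choose (z s) : ℝ)) / ((∑ s, a s).choose (∑ s, z s) : ℝ)

/-- The monomial with exponent vector `c` at the point `ρ`. -/
noncomputable def monomialAt {S : Type*} [Fintype S] (ρ : S → ℝ) (c : S → ℕ) : ℝ :=
  ∏ s, ρ s ^ c s

/-- The complete homogeneous symmetric polynomial of degree `n` at the point `ρ`. -/
noncomputable def completeHomogeneous {S : Type*} [Fintype S] [DecidableEq S]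
    (ρ : S → ℝ) (n : ℕ) : ℝ :=
  ∑ c ∈ piAntidiag univ n, monomialAt ρ c

/-- The probability that a uniformly chosen word with letter counts `a + b` begins with a word with
letter counts `a`. -/
noncomputable def splitRatio {S : Type*} [Fintype S] (a b : S → ℕ) : ℝ :=
  (wordCount a : ℝ) * wordCount b / wordCount (a + b)

/-- A convolution form of Vandermonde's identity (a shifted hockey-stick identity). -/
lemma sum_antidiagonal_choose_mul_choose (k n i j : ℕ) :
    ∑ p ∈ antidiagonal n, p.1.choose i * (p.2 + k).choose (j + k) =
      (n + k + 1).choose (i + j + k + 1) := by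
  induction n generalizing i with
  | zero =>
    rcases Nat.eq_zero_or_pos i with rfl | hi
    · rcases Nat.eq_zero_or_pos j with rfl | hj
      · simp
      · simp [Nat.choose_eq_zero_of_lt (show k < j + k by omega),
          Nat.choose_eq_zero_of_lt (show k + 1 < j + k + 1 by omega)]
    · simp [Nat.choose_eq_zero_of_lt hi,
        Nat.choose_eq_zero_of_lt (show k + 1 < i + j + k + 1 by omega)]
  | succ n ih =>
    rw [Nat.sum_antidiagonal_succ]
    cases i with
    | zero =>
      have := ih 0
      simp only [Nat.choose_zero_right, one_mul, zero_add] at this ⊢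
      rw [this, show n + 1 + k = n + k + 1 by ring]
      exact (Nat.choose_succ_succ _ _).symm
    | succ i =>
      simp only [Nat.choose_succ_succ, Nat.choose_zero_succ, zero_mul, zero_add, add_mul,
        sum_add_distrib]
      rw [ih i]
      have := ih (i + 1)
      simp only [Nat.choose_succ_succ] at this ⊢
      rw [this, show n + 1 + k = n + k + 1 by ring, show i + 1 + j + k = i + j + k + 1 by ring]
      simp only [Nat.choose_succ_succ]

section Compositions

variable {S : Type*}

lemma sum_piAntidiag_prod_choose [DecidableEq S] (z : S → ℕ) (t : Finset S) (ht : t.Nonempty) :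
    ∀ n k : ℕ, #t = k + 1 → ∑ a ∈ piAntidiag t n, ∏ s ∈ t, (a s).choose (z s) =
      (n + k).choose (∑ s ∈ t, z s + k) := by
  induction ht using Finset.Nonempty.cons_induction with
  | singleton s =>
    intro n k hk
    have hk : k = 0 := by simpa using hk
    subst hk
    rw [sum_eq_single (Pi.single s n)]
    · simp
    · intro a ha hne
      rw [mem_piAntidiag] at ha
      exfalso
      apply hne
      funext i
      by_cases hi : i = s
      · subst hi; simpa using ha.1
      · simp only [Pi.single_eq_of_ne hi]
        by_contra h0
        exact hi (by simpa using ha.2 i h0)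
    · intro h
      exfalso
      apply h
      rw [mem_piAntidiag]
      refine ⟨by simp, fun i hi => ?_⟩
      by_contra hne
      exact hi (by simp [Pi.single_eq_of_ne (show i ≠ s by simpa using hne)])
  | cons s t hs htne ih =>
    intro n k hk
    rw [card_cons] at hk
    obtain ⟨k, rfl⟩ : ∃ l, k = l + 1 := ⟨k - 1, by have := htne.card_pos; omega⟩
    have key : ∀ p ∈ antidiagonal n, ∑ a ∈ (piAntidiag t p.2).map
        (addRightEmbedding fun j ↦ if j = s then p.1 else 0),
          ∏ i ∈ cons s t hs, (a i).choose (z i) =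
        p.1.choose (z s) * (p.2 + k).choose (∑ i ∈ t, z i + k) := by
      intro p _
      rw [sum_map, ← ih p.2 k (by omega), mul_sum]
      refine sum_congr rfl fun a ha => ?_
      rw [prod_cons]
      have has : a s = 0 := by
        by_contra h0
        exact hs ((mem_piAntidiag.1 ha).2 s h0)
      congr 1
      · simp [has]
      · refine prod_congr rfl fun i hi => ?_
        have : i ≠ s := fun h => hs (h ▸ hi)
        simp [this]
    rw [piAntidiag_cons, sum_disjiUnion, sum_congr rfl key, sum_antidiagonal_choose_mul_choose,
      sum_cons]
    congr 1

lemma choose_add_le_two_pow_mul (n K : ℕ) :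
    (n + K).choose (n / 2 + K) ≤ 2 ^ K * n.choose (n / 2) := by
  induction K with
  | zero => simp
  | succ K ih =>
    have h := Nat.add_one_mul_choose_eq (n + K) (n / 2 + K)
    have h2 : n + K + 1 ≤ 2 * (n / 2 + K + 1) := by omega
    have h3 : (n + (K + 1)).choose (n / 2 + (K + 1)) * (n / 2 + K + 1) ≤
        2 * (n + K).choose (n / 2 + K) * (n / 2 + K + 1) := by
      rw [← add_assoc, ← add_assoc, ← h]
      nlinarith [Nat.zero_le ((n + K).choose (n / 2 + K))]
    have h4 := Nat.le_of_mul_le_mul_right h3 (by omega)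
    rw [pow_succ]
    nlinarith

variable [Fintype S]

lemma hypergeom_nonneg (a z : S → ℕ) : 0 ≤ hypergeom a z := by
  unfold hypergeom; positivity

lemma hypergeom_eq_zero {a z : S → ℕ} (h : ¬ z ≤ a) : hypergeom a z = 0 := by
  rw [Pi.le_def] at h
  push Not at h
  obtain ⟨s, hs⟩ := h
  unfold hypergeom
  rw [prod_eq_zero (mem_univ s) (by simp [Nat.choose_eq_zero_of_lt hs]), zero_div]

lemma hypergeom_eq {a z : S → ℕ} (h : z ≤ a) :
    hypergeom a z = (wordCount z : ℝ) * wordCount (a - z) / wordCount a := by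
  have hsum : ∑ s, z s ≤ ∑ s, a s := sum_le_sum fun s _ => h s
  have h0 : ((∑ s, a s).choose (∑ s, z s) : ℝ) ≠ 0 := by
    exact_mod_cast (Nat.choose_pos hsum).ne'
  have h1 : (wordCount a : ℝ) ≠ 0 := by exact_mod_cast (wordCount_pos a).ne'
  unfold hypergeom
  rw [div_eq_div_iff h0 h1]
  have hz := prod_factorial_mul_wordCount z
  have ha := prod_factorial_mul_wordCount a
  have haz := prod_factorial_mul_wordCount (a - z)
  rw [sum_sub_eq h] at haz
  have hc := Nat.choose_mul_factorial_mul_factorial hsum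
  have hp : (∏ s, (a s).choose (z s)) * (∏ s, (z s).factorial) * ∏ s, ((a - z) s).factorial =
      ∏ s, (a s).factorial := by
    rw [← prod_mul_distrib, ← prod_mul_distrib]
    exact prod_congr rfl fun s _ => Nat.choose_mul_factorial_mul_factorial (h s)
  have hpos : 0 < (∏ s, (z s).factorial) * ∏ s, ((a - z) s).factorial :=
    Nat.mul_pos (prod_pos fun s _ => Nat.factorial_pos _) (prod_pos fun s _ => Nat.factorial_pos _)
  have key : (∏ s, (a s).choose (z s)) * wordCount a =
      wordCount z * wordCount (a - z) * (∑ s, a s).choose (∑ s, z s) := by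
    apply Nat.eq_of_mul_eq_mul_right hpos
    calc _ = ((∏ s, (a s).choose (z s)) * (∏ s, (z s).factorial) *
          ∏ s, ((a - z) s).factorial) * wordCount a := by ring
      _ = (∑ s, a s).factorial := by rw [hp, ha]
      _ = _ := by rw [← hc, ← hz, ← haz]; ring
  exact_mod_cast key

lemma splitRatio_nonneg (a b : S → ℕ) : 0 ≤ splitRatio a b := by
  unfold splitRatio; positivity

lemma monomialAt_nonneg {ρ : S → ℝ} (hρ : ∀ s, 0 ≤ ρ s) (c : S → ℕ) : 0 ≤ monomialAt ρ c :=
  prod_nonneg fun s _ => pow_nonneg (hρ s) _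

lemma monomialAt_add (ρ : S → ℝ) (a b : S → ℕ) :
    monomialAt ρ (a + b) = monomialAt ρ a * monomialAt ρ b := by
  simp [monomialAt, pow_add, prod_mul_distrib]

lemma monomialAt_anti {ρ : S → ℝ} (hρ : ∀ s, 0 ≤ ρ s) (hρ1 : ∀ s, ρ s ≤ 1) {a b : S → ℕ}
    (h : a ≤ b) : monomialAt ρ b ≤ monomialAt ρ a :=
  prod_le_prod (fun s _ => pow_nonneg (hρ s) _)
    fun s _ => pow_le_pow_of_le_one (hρ s) (hρ1 s) (h s)

variable [DecidableEq S]

/-- For a fixed vector `z`, the total over all `a` of the chance that half of `a` equals `z` is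
bounded independently of `z`. -/
lemma sum_hypergeom_le [Nonempty S] (n : ℕ) (z : S → ℕ) (hz : ∑ s, z s = n / 2) :
    ∑ a ∈ piAntidiag univ n, hypergeom a z ≤ 2 ^ Fintype.card S := by
  obtain ⟨k, hk⟩ : ∃ k, #(univ : Finset S) = k + 1 :=
    ⟨#(univ : Finset S) - 1, by have := (univ_nonempty (α := S)).card_pos; omega⟩
  have h0 : (0 : ℝ) < n.choose (n / 2) := by
    exact_mod_cast Nat.choose_pos (Nat.div_le_self n 2)
  have h1 : ∑ a ∈ piAntidiag (univ : Finset S) n, hypergeom a z =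
      (∑ a ∈ piAntidiag univ n, ∏ s, ((a s).choose (z s) : ℝ)) / n.choose (n / 2) := by
    rw [sum_div]
    refine sum_congr rfl fun a ha => ?_
    rw [hypergeom, mem_piAntidiag_univ.1 ha, hz]
  rw [h1, div_le_iff₀ h0]
  have h2 := sum_piAntidiag_prod_choose z univ univ_nonempty n k hk
  rw [hz] at h2
  have h3 : ∑ a ∈ piAntidiag (univ : Finset S) n, ∏ s, (a s).choose (z s) ≤
      2 ^ Fintype.card S * n.choose (n / 2) := by
    rw [h2, ← card_univ, hk]
    exact (choose_add_le_two_pow_mul n k).trans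
      (Nat.mul_le_mul_right _ (Nat.pow_le_pow_right two_pos (Nat.le_succ k)))
  exact_mod_cast h3

/-- Vandermonde's identity turns a double sum over the two halves of a vector into a single sum. -/
lemma sum_monomialAt_splitRatio (ρ : S → ℝ) (i j : ℕ) :
    ∑ a ∈ piAntidiag univ i, ∑ b ∈ piAntidiag univ j,
      monomialAt ρ a * monomialAt ρ b * splitRatio a b = completeHomogeneous ρ (i + j) := by
  have h : ∀ c ∈ piAntidiag (univ : Finset S) (i + j), monomialAt ρ c =
      ∑ a ∈ subVectors c i, monomialAt ρ a * monomialAt ρ (c - a) * splitRatio a (c - a) := by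
    intro c hc
    have h1 : (wordCount c : ℝ) = ∑ a ∈ subVectors c i, (wordCount a : ℝ) * wordCount (c - a) := by
      exact_mod_cast wordCount_split c (by rw [mem_piAntidiag_univ.1 hc]; omega)
    have h2 : (wordCount c : ℝ) ≠ 0 := by exact_mod_cast (wordCount_pos c).ne'
    calc monomialAt ρ c = monomialAt ρ c *
          ((∑ a ∈ subVectors c i, (wordCount a : ℝ) * wordCount (c - a)) / wordCount c) := by
          rw [← h1, div_self h2, mul_one]
      _ = _ := by
          rw [sum_div, mul_sum]
          refine sum_congr rfl fun a ha => ?_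
          rw [splitRatio, ← monomialAt_add, add_tsub_cancel_of_le (mem_subVectors.1 ha).1]
  rw [completeHomogeneous, sum_congr rfl h, sum_sigma', sum_sigma']
  refine sum_bij' (fun p _ => ⟨p.1 + p.2, p.1⟩) (fun p _ => ⟨p.2, p.1 - p.2⟩) ?_ ?_ ?_ ?_ ?_
  · rintro ⟨a, b⟩ hp
    simp only [mem_sigma, mem_piAntidiag_univ, mem_subVectors] at hp ⊢
    refine ⟨?_, by simp, hp.1⟩
    rw [← hp.1, ← hp.2, ← sum_add_distrib]; rfl
  · rintro ⟨c, a⟩ hp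
    simp only [mem_sigma, mem_piAntidiag_univ, mem_subVectors] at hp ⊢
    refine ⟨hp.2.2, ?_⟩
    rw [sum_sub_eq hp.2.1]; omega
  · rintro ⟨a, b⟩ _
    simp
  · rintro ⟨c, a⟩ hp
    simp only [mem_sigma, mem_subVectors] at hp
    simp [add_tsub_cancel_of_le hp.2.1]
  · rintro ⟨a, b⟩ _
    simp

/-- The average of `splitRatio` over the halves of `a` and of `b`. -/
noncomputable def halvesAverage (a b : S → ℕ) : ℝ :=
  ∑ a' ∈ subVectors a ((∑ s, a s) / 2), ∑ b' ∈ subVectors b ((∑ s, b s) / 2),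
    hypergeom a a' * hypergeom b b' * splitRatio a' b'

/-- If at least the words that run through some halves of `a` and of `b` are counted by `N`, then
the share of the words that run through `a` is at most the average of the shares at the halves. -/
lemma div_le_halvesAverage (a b : S → ℕ) (N : ℝ)
    (hN : ∑ a' ∈ subVectors a ((∑ s, a s) / 2), ∑ b' ∈ subVectors b ((∑ s, b s) / 2),
      (wordCount (a - a') : ℝ) * wordCount (a' + b') * wordCount (b - b') ≤ N) :
    (wordCount a : ℝ) * wordCount b / N ≤ halvesAverage a b := by
  set P := subVectors a ((∑ s, a s) / 2) ×ˢ subVectors b ((∑ s, b s) / 2) with hP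
  have pos : ∀ c : S → ℕ, (0 : ℝ) < wordCount c := fun c => by exact_mod_cast wordCount_pos c
  set f : (S → ℕ) × (S → ℕ) → ℝ := fun p => (wordCount p.1 * wordCount (a - p.1)) *
    (wordCount p.2 * wordCount (b - p.2)) with hf
  set g : (S → ℕ) × (S → ℕ) → ℝ := fun p =>
    wordCount (a - p.1) * wordCount (p.1 + p.2) * wordCount (b - p.2) with hg
  have hgpos : ∀ p, 0 < g p := fun p => mul_pos (mul_pos (pos _) (pos _)) (pos _)
  have hfsum : ∑ p ∈ P, f p = wordCount a * wordCount b := by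
    have h1 : (wordCount a : ℝ) = _ :=
      congrArg Nat.cast (wordCount_split a (Nat.div_le_self (∑ s, a s) 2))
    have h2 : (wordCount b : ℝ) = _ :=
      congrArg Nat.cast (wordCount_split b (Nat.div_le_self (∑ s, b s) 2))
    rw [h1, h2]
    push_cast
    rw [sum_mul_sum, hP, sum_product]
  rw [← sum_product' (f := fun a' b' =>
    (wordCount (a - a') : ℝ) * wordCount (a' + b') * wordCount (b - b')), ← hP] at hN
  have hPne : P.Nonempty := by
    by_contra h
    rw [not_nonempty_iff_eq_empty] at h
    rw [h, sum_empty] at hfsum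
    exact (mul_pos (pos a) (pos b)).ne hfsum
  have hgs : 0 < ∑ p ∈ P, g p := sum_pos (fun p _ => hgpos p) hPne
  have hab := mul_pos (pos a) (pos b)
  have cs := sq_sum_div_le_sum_sq_div P f (fun p _ => hgpos p)
  rw [hfsum] at cs
  calc (wordCount a : ℝ) * wordCount b / N ≤ wordCount a * wordCount b / ∑ p ∈ P, g p :=
        div_le_div_of_nonneg_left hab.le hgs hN
    _ = (wordCount a * wordCount b) ^ 2 / (∑ p ∈ P, g p) / (wordCount a * wordCount b) := by
        field_simp
    _ ≤ (∑ p ∈ P, f p ^ 2 / g p) / (wordCount a * wordCount b) := by gcongr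
    _ = halvesAverage a b := by
        rw [halvesAverage, ← sum_product', ← hP, sum_div]
        refine sum_congr rfl fun p hp => ?_
        rw [hP, mem_product, mem_subVectors, mem_subVectors] at hp
        rw [hypergeom_eq hp.1.1, hypergeom_eq hp.2.1, splitRatio, hf, hg]
        have h1 := (pos (a - p.1)).ne'
        have h2 := (pos (b - p.2)).ne'
        have h3 := (pos (p.1 + p.2)).ne'
        have h4 := (pos a).ne'
        have h5 := (pos b).ne'
        simp only
        field_simp

lemma sum_subVectors_hypergeom_mul (a : S → ℕ) (i : ℕ) (f : (S → ℕ) → ℝ) :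
    ∑ z ∈ subVectors a i, hypergeom a z * f z =
      ∑ z ∈ piAntidiag univ i, hypergeom a z * f z := by
  refine sum_subset (subVectors_subset a i) fun z hz hz' => ?_
  rw [hypergeom_eq_zero, zero_mul]
  exact fun h => hz' (mem_subVectors.2 ⟨h, mem_piAntidiag_univ.1 hz⟩)

/-- The halving averages, weighted by the monomials, sum to at most a constant times a single
complete homogeneous value: each pair of halves is reached with bounded total hypergeometric mass. -/
lemma sum_monomialAt_halvesAverage_le [Nonempty S] {ρ : S → ℝ} (hρ : ∀ s, 0 ≤ ρ s)
    (hρ1 : ∀ s, ρ s ≤ 1) (m n : ℕ) :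
    ∑ a ∈ piAntidiag univ m, ∑ b ∈ piAntidiag univ n,
      monomialAt ρ a * monomialAt ρ b * halvesAverage a b ≤
      (2 ^ Fintype.card S) ^ 2 * completeHomogeneous ρ (m / 2 + n / 2) := by
  set W : (S → ℕ) → (S → ℕ) → ℝ := fun a' b' =>
    monomialAt ρ a' * monomialAt ρ b' * splitRatio a' b' with hW
  have hWnn : ∀ a' b', 0 ≤ W a' b' := fun a' b' =>
    mul_nonneg (mul_nonneg (monomialAt_nonneg hρ _) (monomialAt_nonneg hρ _))
      (splitRatio_nonneg _ _)
  calc _ ≤ ∑ a ∈ piAntidiag univ m, ∑ b ∈ piAntidiag univ n,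
        ∑ a' ∈ piAntidiag univ (m / 2), ∑ b' ∈ piAntidiag univ (n / 2),
          hypergeom a a' * hypergeom b b' * W a' b' := by
        refine sum_le_sum fun a ha => sum_le_sum fun b hb => ?_
        rw [mem_piAntidiag_univ] at ha hb
        calc _ ≤ ∑ a' ∈ subVectors a (m / 2), hypergeom a a' *
                ∑ b' ∈ subVectors b (n / 2), hypergeom b b' * W a' b' := by
              rw [halvesAverage, ha, hb, mul_sum]
              refine sum_le_sum fun a' ha' => ?_
              rw [mul_sum, mul_sum]
              refine sum_le_sum fun b' hb' => ?_
              have h1 := monomialAt_anti hρ hρ1 (mem_subVectors.1 ha').1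
              have h2 := monomialAt_anti hρ hρ1 (mem_subVectors.1 hb').1
              have h3 := mul_le_mul h1 h2 (monomialAt_nonneg hρ _) (monomialAt_nonneg hρ _)
              have h4 : 0 ≤ hypergeom a a' * hypergeom b b' * splitRatio a' b' :=
                mul_nonneg (mul_nonneg (hypergeom_nonneg _ _) (hypergeom_nonneg _ _))
                  (splitRatio_nonneg _ _)
              calc _ ≤ monomialAt ρ a' * monomialAt ρ b' *
                    (hypergeom a a' * hypergeom b b' * splitRatio a' b') :=
                    mul_le_mul_of_nonneg_right h3 h4
                _ = _ := by rw [hW]; ring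
          _ = _ := by
              rw [sum_subVectors_hypergeom_mul]
              refine sum_congr rfl fun a' _ => ?_
              rw [sum_subVectors_hypergeom_mul, mul_sum]
              exact sum_congr rfl fun b' _ => by ring
    _ = ∑ a' ∈ piAntidiag univ (m / 2), ∑ b' ∈ piAntidiag univ (n / 2),
          (∑ a ∈ piAntidiag univ m, hypergeom a a') * (∑ b ∈ piAntidiag univ n, hypergeom b b') *
            W a' b' := by
        simp_rw [sum_mul_sum, sum_mul]
        rw [sum_congr rfl fun a _ => sum_comm, sum_comm]
        refine sum_congr rfl fun a' _ => ?_
        rw [sum_congr rfl fun a _ => sum_comm, sum_comm]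
    _ ≤ ∑ a' ∈ piAntidiag univ (m / 2), ∑ b' ∈ piAntidiag univ (n / 2),
          (2 ^ Fintype.card S) ^ 2 * W a' b' := by
        refine sum_le_sum fun a' ha' => sum_le_sum fun b' hb' => ?_
        rw [sq]
        refine mul_le_mul_of_nonneg_right (mul_le_mul (sum_hypergeom_le m a' ?_)
          (sum_hypergeom_le n b' ?_) (sum_nonneg fun _ _ => hypergeom_nonneg _ _) (by positivity))
          (hWnn a' b')
        · exact mem_piAntidiag_univ.1 ha'
        · exact mem_piAntidiag_univ.1 hb'
    _ = _ := by
        rw [← sum_monomialAt_splitRatio, mul_sum]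
        exact sum_congr rfl fun a' _ => by rw [mul_sum]

end Compositions

/-! ### Growth of complete homogeneous polynomials -/

section Growth

variable {S : Type*} [Fintype S] [DecidableEq S]

lemma sum_piFinset_monomialAt (ρ : S → ℝ) (t : S → Finset ℕ) :
    ∑ e ∈ Fintype.piFinset t, monomialAt ρ e = ∏ s, ∑ x ∈ t s, ρ s ^ x :=
  (prod_univ_sum t fun s x => ρ s ^ x).symm

lemma monomialAt_update {ρ : S → ℝ} {s₀ : S} (h₀ : ρ s₀ = 1) (c : S → ℕ) (x : ℕ) :
    monomialAt ρ (Function.update c s₀ x) = monomialAt ρ c := by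
  refine prod_congr rfl fun s _ => ?_
  by_cases h : s = s₀
  · subst h; simp [h₀]
  · simp [h]

/-- If `ρ` has its maximal value `1` at `k` places, then the complete homogeneous symmetric
polynomial of degree `n` is `O(n ^ (k - 1))` at `ρ`: the exponent at one of these places is
determined by the others, and the places with `ρ < 1` contribute geometric series. -/
lemma exists_completeHomogeneous_le {ρ : S → ℝ} (hρ : ∀ s, 0 ≤ ρ s) (hρ1 : ∀ s, ρ s ≤ 1)
    {s₀ : S} (h₀ : ρ s₀ = 1) :
    ∃ C : ℝ, 0 < C ∧ ∀ n : ℕ,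
      completeHomogeneous ρ n ≤ C * ((n : ℝ) + 1) ^ (#{s | ρ s = 1} - 1) := by
  have hlt : ∀ s, ρ s ≠ 1 → 0 < 1 - ρ s := fun s hs => by
    have := lt_of_le_of_ne (hρ1 s) hs; linarith
  refine ⟨∏ s, if ρ s = 1 then 1 else (1 - ρ s)⁻¹, prod_pos fun s _ => ?_, fun n => ?_⟩
  · split_ifs with h
    · exact one_pos
    · exact inv_pos.2 (hlt s h)
  set t : S → Finset ℕ := fun s => if s = s₀ then {0} else range (n + 1) with ht
  have h1 : completeHomogeneous ρ n ≤ ∑ e ∈ Fintype.piFinset t, monomialAt ρ e := by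
    have hinj : Set.InjOn (fun c : S → ℕ => Function.update c s₀ 0)
        (piAntidiag (univ : Finset S) n : Finset (S → ℕ)) := by
      intro c hc c' hc' h
      simp only [mem_coe, mem_piAntidiag_univ] at hc hc'
      have hne : ∀ s, s ≠ s₀ → c s = c' s := fun s hs => by
        have := congr_fun h s
        simpa [hs] using this
      funext s
      by_cases hs : s = s₀
      · subst hs
        rw [← add_sum_erase univ _ (mem_univ s)] at hc hc'
        have hrest : ∑ i ∈ univ.erase s, c i = ∑ i ∈ univ.erase s, c' i :=
          sum_congr rfl fun i hi => hne i (mem_erase.1 hi).1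
        omega
      · exact hne s hs
    calc completeHomogeneous ρ n =
          ∑ c ∈ piAntidiag univ n, monomialAt ρ (Function.update c s₀ 0) :=
          sum_congr rfl fun c _ => (monomialAt_update h₀ c 0).symm
      _ = ∑ e ∈ (piAntidiag univ n).image fun c => Function.update c s₀ 0, monomialAt ρ e :=
          (sum_image hinj).symm
      _ ≤ _ := by
          refine sum_le_sum_of_subset_of_nonneg ?_ fun e _ _ => monomialAt_nonneg hρ e
          intro e he
          obtain ⟨c, hc, rfl⟩ := mem_image.1 he
          rw [mem_piAntidiag_univ] at hc
          rw [Fintype.mem_piFinset]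
          intro s
          by_cases hs : s = s₀
          · subst hs; simp [ht]
          · have := single_le_sum (f := c) (fun _ _ => Nat.zero_le _) (mem_univ s)
            simp only [ht, hs, if_false, ne_eq, not_false_eq_true, Function.update_of_ne, mem_range]
            omega
  refine h1.trans ?_
  have h2 : ((n : ℝ) + 1) ^ (#{s | ρ s = 1} - 1) =
      ∏ s, if s ∈ ({s | ρ s = 1} : Finset S).erase s₀ then (n : ℝ) + 1 else 1 := by
    rw [prod_ite_mem, univ_inter, prod_const, card_erase_of_mem (by simp [h₀])]
  rw [h2, ← prod_mul_distrib, sum_piFinset_monomialAt]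
  refine prod_le_prod (fun s _ => sum_nonneg fun _ _ => pow_nonneg (hρ s) _) fun s _ => ?_
  by_cases hs : s = s₀
  · subst hs; simp [ht, h₀]
  · by_cases hs1 : ρ s = 1
    · simp [ht, hs, hs1]
    · simp only [ht, hs, hs1, if_false, mem_erase, mem_filter, mem_univ, and_false, mul_one]
      have hl := hlt s hs1
      rw [← one_div, le_div_iff₀ hl, geom_sum_mul_neg]
      linarith [pow_nonneg (hρ s) (n + 1)]

/-- The lower bound matching `exists_completeHomogeneous_le`: the exponents at all but one of the
places with `ρ = 1` can be chosen freely up to a fixed fraction of `n`. -/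
lemma exists_le_completeHomogeneous {ρ : S → ℝ} (hρ : ∀ s, 0 ≤ ρ s) {s₀ : S} (h₀ : ρ s₀ = 1) :
    ∃ c : ℝ, 0 < c ∧ ∀ n : ℕ,
      c * ((n : ℝ) + 1) ^ (#{s | ρ s = 1} - 1) ≤ completeHomogeneous ρ n := by
  have hK : 0 < Fintype.card S := Fintype.card_pos_iff.2 ⟨s₀⟩
  refine ⟨((Fintype.card S : ℝ)⁻¹) ^ (#{s | ρ s = 1} - 1), by positivity, fun n => ?_⟩
  -- `s₀` absorbs what is left of the degree when the other places with `ρ = 1` have exponents up to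
  -- `n / |S|`
  set m := n / Fintype.card S with hm
  set t : S → Finset ℕ := fun s =>
    if s ∈ ({s | ρ s = 1} : Finset S).erase s₀ then range (m + 1) else {0} with ht
  have hts : ∀ e ∈ Fintype.piFinset t, e s₀ = 0 := fun e he => by
    have := Fintype.mem_piFinset.1 he s₀
    simpa [ht] using this
  have htle : ∀ e ∈ Fintype.piFinset t, ∑ s, e s ≤ n := fun e he => by
    calc ∑ s, e s ≤ ∑ _s : S, m := sum_le_sum fun s _ => by
          have := Fintype.mem_piFinset.1 he s
          simp only [ht] at this
          split_ifs at this
          · rw [mem_range] at this; omega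
          · rw [mem_singleton] at this; rw [this]; exact Nat.zero_le _
      _ = Fintype.card S * m := by simp
      _ ≤ n := Nat.mul_div_le n _
  set φ : (S → ℕ) → S → ℕ := fun e => Function.update e s₀ (n - ∑ s, e s) with hφ
  have hinj : Set.InjOn φ (Fintype.piFinset t : Finset (S → ℕ)) := by
    intro e he e' he' h
    funext s
    by_cases hs : s = s₀
    · subst hs; rw [hts e he, hts e' he']
    · have := congr_fun h s
      simpa [hφ, hs] using this
  have h1 : ∑ e ∈ Fintype.piFinset t, monomialAt ρ e ≤ completeHomogeneous ρ n := by
    calc ∑ e ∈ Fintype.piFinset t, monomialAt ρ e =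
          ∑ e ∈ Fintype.piFinset t, monomialAt ρ (φ e) :=
          sum_congr rfl fun e _ => (monomialAt_update h₀ e _).symm
      _ = ∑ c ∈ (Fintype.piFinset t).image φ, monomialAt ρ c := (sum_image hinj).symm
      _ ≤ _ := by
          refine sum_le_sum_of_subset_of_nonneg ?_ fun e _ _ => monomialAt_nonneg hρ e
          intro c hc
          obtain ⟨e, he, rfl⟩ := mem_image.1 hc
          have hle := htle e he
          rw [mem_piAntidiag_univ, hφ, sum_update_of_mem (mem_univ s₀)]
          have h3 : ∑ s, e s = ∑ s ∈ univ \ {s₀}, e s := by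
            rw [← sum_sdiff (subset_univ {s₀}), sum_singleton, hts e he, add_zero]
          omega
  refine le_trans ?_ h1
  rw [sum_piFinset_monomialAt, ← mul_pow, ← card_erase_of_mem (a := s₀) (by simp [h₀]),
    ← prod_const, ← univ_inter ((_ : Finset S).erase s₀), ← prod_ite_mem]
  refine prod_le_prod (fun s _ => by split_ifs <;> positivity) fun s _ => ?_
  by_cases hs : s ∈ ({s | ρ s = 1} : Finset S).erase s₀
  · have hs1 : ρ s = 1 := by simpa using (mem_erase.1 hs).2
    simp only [ht, if_pos hs, hs1, one_pow, sum_const, card_range, nsmul_eq_mul, mul_one]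
    rw [inv_mul_le_iff₀ (by exact_mod_cast hK)]
    have : n + 1 ≤ Fintype.card S * (m + 1) := by
      have h3 := Nat.div_add_mod n (Fintype.card S)
      have h4 := Nat.mod_lt n hK
      rw [hm, mul_add, mul_one]; omega
    exact_mod_cast this
  · simp only [ht, if_neg hs, sum_singleton, pow_zero, le_refl]

end Growth

/-! ### Distances and spheres in regular trees -/

section Tree

variable {V : Type*} {T : SimpleGraph V}

lemma exists_adj_dist_add_one (hT : T.IsTree) {u w : V} (h : u ≠ w) :
    ∃ u', T.Adj u u' ∧ T.dist u' w + 1 = T.dist u w := by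
  obtain ⟨q, hq⟩ := hT.connected.exists_walk_length_eq_dist u w
  cases q with
  | nil => exact absurd rfl h
  | @cons _ u' _ hadj q =>
    refine ⟨u', hadj, ?_⟩
    rw [SimpleGraph.Walk.length_cons] at hq
    have h1 := SimpleGraph.dist_le q
    have h2 := hT.connected.dist_triangle (u := u) (v := u') (w := w)
    rw [SimpleGraph.dist_eq_one_iff_adj.2 hadj] at h2
    omega

lemma eq_of_adj_of_dist_lt (hT : T.IsTree) {u u₁ u₂ w : V} (h₁ : T.Adj u u₁) (h₂ : T.Adj u u₂)
    (hd₁ : T.dist u₁ w < T.dist u w) (hd₂ : T.dist u₂ w < T.dist u w) : u₁ = u₂ := by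
  obtain ⟨q₁, hq₁⟩ := hT.connected.exists_walk_length_eq_dist u₁ w
  obtain ⟨q₂, hq₂⟩ := hT.connected.exists_walk_length_eq_dist u₂ w
  have p₁ : (SimpleGraph.Walk.cons h₁ q₁).IsPath := by
    apply SimpleGraph.Walk.isPath_of_length_eq_dist
    have := SimpleGraph.dist_le (SimpleGraph.Walk.cons h₁ q₁)
    rw [SimpleGraph.Walk.length_cons] at this ⊢
    omega
  have p₂ : (SimpleGraph.Walk.cons h₂ q₂).IsPath := by
    apply SimpleGraph.Walk.isPath_of_length_eq_dist
    have := SimpleGraph.dist_le (SimpleGraph.Walk.cons h₂ q₂)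
    rw [SimpleGraph.Walk.length_cons] at this ⊢
    omega
  have := (hT.existsUnique_path u w).unique p₁ p₂
  have h := congrArg (fun q => q.getVert 1) this
  simpa using h

open scoped Classical in
/-- The neighbour of `u` on the path to `w` in the tree `T`, and `w` itself if `u = w`. -/
noncomputable def stepToward (T : SimpleGraph V) (w u : V) : V :=
  if h : ∃ u', T.Adj u u' ∧ T.dist u' w + 1 = T.dist u w then h.choose else u

lemma stepToward_self (w : V) : stepToward T w w = w := by
  rw [stepToward, dif_neg]
  simp

lemma stepToward_adj (hT : T.IsTree) {u w : V} (h : u ≠ w) : T.Adj u (stepToward T w u) := by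
  have h' := exists_adj_dist_add_one hT h
  rw [stepToward, dif_pos h']
  exact h'.choose_spec.1

lemma dist_stepToward (hT : T.IsTree) {u w : V} (h : u ≠ w) :
    T.dist (stepToward T w u) w + 1 = T.dist u w := by
  have h' := exists_adj_dist_add_one hT h
  rw [stepToward, dif_pos h']
  exact h'.choose_spec.2

lemma eq_stepToward (hT : T.IsTree) {u u' w : V} (h : T.Adj u u')
    (hd : T.dist u' w < T.dist u w) : u' = stepToward T w u := by
  have hne : u ≠ w := by
    rintro rfl
    simp at hd
  refine eq_of_adj_of_dist_lt hT h (stepToward_adj hT hne) hd ?_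
  have := dist_stepToward hT hne
  omega

lemma dist_stepToward_le (hT : T.IsTree) (u w : V) : T.dist u (stepToward T w u) ≤ 1 := by
  by_cases h : u = w
  · subst h; simp [stepToward_self]
  · rw [SimpleGraph.dist_eq_one_iff_adj.2 (stepToward_adj hT h)]

lemma dist_iterate_stepToward (hT : T.IsTree) (u w : V) {n : ℕ} (hn : n ≤ T.dist u w) :
    T.dist ((stepToward T w)^[n] u) w + n = T.dist u w := by
  induction n with
  | zero => simp
  | succ n ih =>
    have ih := ih (by omega)
    rw [Function.iterate_succ_apply']
    have hne : (stepToward T w)^[n] u ≠ w := by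
      intro h
      rw [h, SimpleGraph.dist_self] at ih
      omega
    have := dist_stepToward hT hne
    omega

lemma iterate_stepToward_eq (hT : T.IsTree) (u w : V) :
    (stepToward T w)^[T.dist u w] u = w := by
  have := dist_iterate_stepToward hT u w le_rfl
  exact hT.connected.dist_eq_zero_iff.1 (by omega)

lemma dist_iterate_iterate_le (hT : T.IsTree) (u w : V) (m n : ℕ) :
    T.dist ((stepToward T w)^[m] u) ((stepToward T w)^[m + n] u) ≤ n := by
  induction n with
  | zero => simp
  | succ n ih =>
    rw [← add_assoc, Function.iterate_succ_apply']
    have h1 := hT.connected.dist_triangle (u := (stepToward T w)^[m] u)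
      (v := (stepToward T w)^[m + n] u)
      (w := stepToward T w ((stepToward T w)^[m + n] u))
    have h2 := dist_stepToward_le hT ((stepToward T w)^[m + n] u) w
    omega

lemma dist_self_iterate (hT : T.IsTree) (u w : V) {n : ℕ} (hn : n ≤ T.dist u w) :
    T.dist u ((stepToward T w)^[n] u) = n := by
  have h1 := dist_iterate_iterate_le hT u w 0 n
  have h2 := dist_iterate_stepToward hT u w hn
  have h3 := hT.connected.dist_triangle (u := u) (v := (stepToward T w)^[n] u) (w := w)
  simp only [Function.iterate_zero, id, zero_add] at h1
  omega

/-- A vertex `v` on the path from `u` to `w` is reached from `u` by steps toward `w`. -/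
lemma iterate_stepToward_of_between (hT : T.IsTree) {u v w : V}
    (h : T.dist u v + T.dist v w = T.dist u w) : (stepToward T w)^[T.dist u v] u = v := by
  induction hn : T.dist u v generalizing u with
  | zero => exact hT.connected.dist_eq_zero_iff.1 hn
  | succ n ih =>
    have hne : u ≠ v := by
      rintro rfl
      simp at hn
    have h1 := dist_stepToward hT hne
    have h2 := stepToward_adj hT hne
    have h3 := hT.connected.dist_triangle (u := stepToward T v u) (v := v) (w := w)
    have h4 := hT.connected.dist_triangle (u := u) (v := stepToward T v u) (w := w)
    rw [SimpleGraph.dist_eq_one_iff_adj.2 h2] at h4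
    have h5 : stepToward T v u = stepToward T w u := eq_stepToward hT h2 (by omega)
    rw [Function.iterate_succ_apply, ← h5]
    exact ih (by omega) (by omega)

/-- Either `v` lies on the path from `u` to `w`, or the paths from `v` to `u` and to `w` have their
first step in common. -/
lemma between_or_exists_common_step (hT : T.IsTree) (v u w : V) :
    T.dist u w = T.dist v u + T.dist v w ∨
      ∃ y, T.Adj v y ∧ T.dist y u + 1 = T.dist v u ∧ T.dist y w + 1 = T.dist v w := by
  induction hn : T.dist v u generalizing u with
  | zero =>
    left
    rw [hT.connected.dist_eq_zero_iff.1 hn, zero_add]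
  | succ n ih =>
    have hne : u ≠ v := by
      rintro rfl
      simp at hn
    have h1 := dist_stepToward hT hne
    have h2 := stepToward_adj hT hne
    set u' := stepToward T v u
    rw [SimpleGraph.dist_comm, SimpleGraph.dist_comm (u := u)] at h1
    have hn' : T.dist v u' = n := by omega
    rcases ih u' hn' with h | ⟨y, hy, hyu, hyw⟩
    · rcases hT.dist_eq_dist_add_one_of_adj w h2 with h3 | h3
      · left
        rw [SimpleGraph.dist_comm, h3, SimpleGraph.dist_comm, h]
        omega
      · rw [SimpleGraph.dist_comm, SimpleGraph.dist_comm (u := w)] at h3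
        right
        rcases Nat.eq_zero_or_pos n with rfl | hpos
        · have hv : v = u' := hT.connected.dist_eq_zero_iff.1 hn'
          exact ⟨u, hv ▸ h2.symm, by simp, by rw [hv]; exact h3.symm⟩
        · exfalso
          have hne' : u' ≠ v := by
            intro h0
            rw [h0, SimpleGraph.dist_self] at hn'
            omega
          have h4 := dist_stepToward hT hne'
          have h5 := stepToward_adj hT hne'
          have h6 := hT.connected.dist_triangle (u := stepToward T v u') (v := v) (w := w)
          rw [SimpleGraph.dist_comm (u := u')] at h4
          have h7 := eq_of_adj_of_dist_lt hT h2.symm h5 (w := w) (by omega) (by omega)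
          rw [← h7, SimpleGraph.dist_comm] at h4
          omega
    · right
      refine ⟨y, hy, ?_, hyw⟩
      have h3 := hT.connected.dist_triangle (u := v) (v := y) (w := u)
      have h4 := hT.connected.dist_triangle (u := y) (v := u') (w := u)
      rw [SimpleGraph.dist_eq_one_iff_adj.2 hy] at h3
      rw [SimpleGraph.dist_eq_one_iff_adj.2 h2.symm] at h4
      omega

open scoped Classical in
/-- The sphere of radius `n` around `v`. -/
noncomputable def sphereFinset (T : SimpleGraph V) [T.LocallyFinite] (v : V) : ℕ → Finset V
  | 0 => {v}
  | n + 1 => (sphereFinset T v n).biUnion fun u => {u' ∈ T.neighborFinset u | T.dist v u' = n + 1}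

variable [T.LocallyFinite]

lemma mem_sphereFinset (hT : T.IsTree) {v u : V} {n : ℕ} :
    u ∈ sphereFinset T v n ↔ T.dist v u = n := by
  induction n generalizing u with
  | zero =>
    rw [sphereFinset, mem_singleton, hT.connected.dist_eq_zero_iff, eq_comm]
  | succ n ih =>
    simp only [sphereFinset, mem_biUnion, mem_filter, SimpleGraph.mem_neighborFinset]
    constructor
    · rintro ⟨_, _, _, h⟩
      exact h
    · intro h
      have hne : u ≠ v := by
        rintro rfl
        simp at h
      refine ⟨stepToward T v u, ih.2 ?_, (stepToward_adj hT hne).symm, h⟩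
      have := dist_stepToward hT hne
      rw [SimpleGraph.dist_comm, SimpleGraph.dist_comm (u := u)] at this
      omega

lemma card_sphereFinset_succ_le (hT : T.IsTree) {d : ℕ} (hd : T.IsRegularOfDegree (d + 1)) (v : V)
    {n : ℕ} (hn : 1 ≤ n) : #(sphereFinset T v (n + 1)) ≤ #(sphereFinset T v n) * d := by
  classical
  rw [sphereFinset]
  refine card_biUnion_le_card_mul _ _ _ fun u hu => ?_
  rw [mem_sphereFinset hT] at hu
  have hne : u ≠ v := by
    rintro rfl
    simp at hu
    omega
  have h1 := dist_stepToward hT hne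
  have hsub : {u' ∈ T.neighborFinset u | T.dist v u' = n + 1} ⊆
      (T.neighborFinset u).erase (stepToward T v u) := by
    intro u' hu'
    rw [mem_filter] at hu'
    refine mem_erase.2 ⟨?_, hu'.1⟩
    rintro rfl
    rw [SimpleGraph.dist_comm, hu'.2, SimpleGraph.dist_comm, hu] at h1
    omega
  calc _ ≤ #((T.neighborFinset u).erase (stepToward T v u)) := card_le_card hsub
    _ = d := by
      rw [card_erase_of_mem ((T.mem_neighborFinset u _).2 (stepToward_adj hT hne)),
        SimpleGraph.card_neighborFinset_eq_degree, hd.degree_eq]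
      rfl

lemma card_sphereFinset_le (hT : T.IsTree) {d : ℕ} (hd1 : 1 ≤ d) (hd : T.IsRegularOfDegree (d + 1))
    (v : V) (n : ℕ) : #(sphereFinset T v n) ≤ 2 * d ^ n := by
  classical
  cases n with
  | zero => simp [sphereFinset]
  | succ n =>
    induction n with
    | zero =>
      simp only [sphereFinset, singleton_biUnion]
      refine (card_filter_le _ _).trans ?_
      rw [SimpleGraph.card_neighborFinset_eq_degree, hd.degree_eq, zero_add, pow_one]
      omega
    | succ n ih =>
      refine (card_sphereFinset_succ_le hT hd v (by omega)).trans ?_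
      calc _ ≤ 2 * d ^ (n + 1) * d := Nat.mul_le_mul_right _ ih
        _ = _ := by ring

open scoped Classical in
/-- The vertices `u` at distance `n` from `v` for which `v` lies on the path from `u` to `w`. -/
noncomputable def oppositeFinset (T : SimpleGraph V) [T.LocallyFinite] (v w : V) (n : ℕ) :
    Finset V :=
  {u ∈ sphereFinset T v n | T.dist u w = n + T.dist v w}

lemma mem_oppositeFinset (hT : T.IsTree) {v w u : V} {n : ℕ} :
    u ∈ oppositeFinset T v w n ↔ T.dist v u = n ∧ T.dist u w = n + T.dist v w := by
  rw [oppositeFinset, mem_filter, mem_sphereFinset hT]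

lemma pow_le_card_oppositeFinset (hT : T.IsTree) {d : ℕ} (hd : T.IsRegularOfDegree (d + 1))
    (v w : V) (n : ℕ) : d ^ n ≤ #(oppositeFinset T v w n) := by
  classical
  induction n with
  | zero =>
    rw [pow_zero, Nat.one_le_iff_ne_zero, ← Nat.pos_iff_ne_zero, card_pos]
    exact ⟨v, (mem_oppositeFinset hT).2 (by simp)⟩
  | succ n ih =>
    have hstep : ∀ u ∈ oppositeFinset T v w n,
        ∀ u' ∈ (T.neighborFinset u).erase (stepToward T w u),
          T.Adj u u' ∧ T.dist u' w = T.dist u w + 1 := by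
      intro u _ u' hu'
      rw [mem_erase, SimpleGraph.mem_neighborFinset] at hu'
      refine ⟨hu'.2, ?_⟩
      rcases hT.dist_eq_dist_add_one_of_adj w hu'.2 with h | h
      · rw [SimpleGraph.dist_comm, SimpleGraph.dist_comm (u := w)] at h
        exact absurd (eq_stepToward hT hu'.2 (by omega)) hu'.1
      · rw [SimpleGraph.dist_comm, h, SimpleGraph.dist_comm]
    have hsub : (oppositeFinset T v w n).biUnion
        (fun u => (T.neighborFinset u).erase (stepToward T w u)) ⊆
          oppositeFinset T v w (n + 1) := by
      intro u' hu'
      obtain ⟨u, hu, hu'⟩ := mem_biUnion.1 hu'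
      obtain ⟨hadj, h1⟩ := hstep u hu u' hu'
      rw [mem_oppositeFinset hT] at hu ⊢
      have h2 := hT.connected.dist_triangle (u := v) (v := u) (w := u')
      have h3 := hT.connected.dist_triangle (u := u') (v := v) (w := w)
      rw [SimpleGraph.dist_eq_one_iff_adj.2 hadj] at h2
      rw [SimpleGraph.dist_comm (u := u') (v := v)] at h3
      omega
    refine le_trans ?_ (card_le_card hsub)
    rw [card_biUnion]
    · calc d ^ (n + 1) = d ^ n * d := pow_succ _ _
        _ ≤ #(oppositeFinset T v w n) * d := Nat.mul_le_mul_right _ ih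
        _ = ∑ _u ∈ oppositeFinset T v w n, d := by simp
        _ ≤ _ := by
          refine sum_le_sum fun u _ => ?_
          have := pred_card_le_card_erase (s := T.neighborFinset u) (a := stepToward T w u)
          rw [SimpleGraph.card_neighborFinset_eq_degree, hd.degree_eq] at this
          omega
    · intro u₁ hu₁ u₂ hu₂ hne
      rw [Function.onFun, disjoint_left]
      intro u' h₁ h₂
      obtain ⟨a₁, d₁⟩ := hstep u₁ hu₁ u' h₁
      obtain ⟨a₂, d₂⟩ := hstep u₂ hu₂ u' h₂
      exact hne (eq_of_adj_of_dist_lt hT a₁.symm a₂.symm (w := w) (by omega) (by omega))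

lemma pow_le_card_sphereFinset (hT : T.IsTree) {d : ℕ} (hd : T.IsRegularOfDegree (d + 1))
    (v : V) (n : ℕ) : d ^ n ≤ #(sphereFinset T v n) := by
  classical
  exact (pow_le_card_oppositeFinset hT hd v v n).trans (card_filter_le _ _)

end Tree

/-! ### Geodesics in a product of trees -/

section Product

variable {S : Type*} {V : S → Type*} {T : ∀ s, SimpleGraph (V s)}

/-- The point reached from `u` after `x s` steps toward `w` in each coordinate `s`. -/
noncomputable def progressPoint (T : ∀ s, SimpleGraph (V s)) (u w : ∀ s, V s) (x : S → ℕ) :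
    ∀ s, V s :=
  fun s => (stepToward (T s) (w s))^[x s] (u s)

/-- The walks of length `n` all of whose vertices satisfy `C`. -/
def walksWithin {W : Type*} (G : SimpleGraph W) (C : W → Prop) (u w : W) (n : ℕ) :
    Set (G.Walk u w) :=
  {q | q.length = n ∧ ∀ y ∈ q.support, C y}

lemma walksWithin_zero {W : Type*} (G : SimpleGraph W) (C : W → Prop) [DecidablePred C] (u : W) :
    (walksWithin G C u u 0).Finite ∧ (walksWithin G C u u 0).ncard = if C u then 1 else 0 := by
  have h : walksWithin G C u u 0 = if C u then {SimpleGraph.Walk.nil} else ∅ := by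
    ext q
    constructor
    · rintro ⟨h1, h2⟩
      rw [if_pos (h2 u q.start_mem_support)]
      exact SimpleGraph.Walk.eq_nil_iff_nil.2 (SimpleGraph.Walk.length_eq_zero_iff.1 h1)
    · intro hq
      split_ifs at hq with h
      · rw [Set.mem_singleton_iff] at hq
        subst hq
        exact ⟨rfl, by simpa using h⟩
      · exact absurd hq (Set.notMem_empty _)
  rw [h]
  split_ifs <;> simp

lemma exists_eq_cons_of_length_eq_succ {W : Type*} {G : SimpleGraph W} {u w : W} {n : ℕ}
    (q : G.Walk u w) (hq : q.length = n + 1) :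
    ∃ (u' : W) (h : G.Adj u u') (q' : G.Walk u' w), q = SimpleGraph.Walk.cons h q' := by
  cases q with
  | nil => simp at hq
  | cons h q' => exact ⟨_, h, q', rfl⟩

lemma progressPoint_dist (hT : ∀ s, (T s).IsTree) (u w : ∀ s, V s) :
    progressPoint T u w (fun s => (T s).dist (u s) (w s)) = w :=
  funext fun s => iterate_stepToward_eq (hT s) _ _

section

variable [DecidableEq S]

lemma boxProdPi_adj_update {u : ∀ s, V s} {s : S} {y : V s} (h : (T s).Adj (u s) y) :
    (boxProdPi T).Adj u (Function.update u s y) :=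
  ⟨s, by simpa using h, fun j hj => by simp [hj]⟩

lemma progressPoint_add_single_of_ne (u w : ∀ s, V s) (x : S → ℕ) {s i : S} (h : i ≠ s) :
    progressPoint T u w (x + Pi.single s 1) i = progressPoint T u w x i := by
  simp [progressPoint, h]

lemma progressPoint_add_single_same (u w : ∀ s, V s) (x : S → ℕ) (s : S) :
    progressPoint T u w (x + Pi.single s 1) s =
      stepToward (T s) (w s) (progressPoint T u w x s) := by
  simp [progressPoint, Function.iterate_succ_apply']

lemma progressPoint_add_single (u w : ∀ s, V s) (x : S → ℕ) (s : S) :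
    progressPoint T u w (x + Pi.single s 1) =
      Function.update (progressPoint T u w x) s
        (stepToward (T s) (w s) (progressPoint T u w x s)) := by
  funext i
  by_cases h : i = s
  · subst h; rw [progressPoint_add_single_same, Function.update_self]
  · rw [progressPoint_add_single_of_ne _ _ _ h, Function.update_of_ne h]

end

variable [Fintype S]

lemma dist_progressPoint (hT : ∀ s, (T s).IsTree) {u w : ∀ s, V s} {x : S → ℕ}
    (hx : x ≤ fun s => (T s).dist (u s) (w s)) :
    ∑ s, (T s).dist (progressPoint T u w x s) (w s) + ∑ s, x s =
      ∑ s, (T s).dist (u s) (w s) := by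
  rw [← sum_add_distrib]
  exact sum_congr rfl fun s _ => dist_iterate_stepToward (hT s) _ _ (hx s)

variable [DecidableEq S]

lemma sum_dist_update_add {u v : ∀ s, V s} {s : S} (y : V s) :
    ∑ i, (T i).dist (u i) (Function.update v s y i) + (T s).dist (u s) (v s) =
      ∑ i, (T i).dist (u i) (v i) + (T s).dist (u s) y := by
  rw [← add_sum_erase univ _ (mem_univ s),
    ← add_sum_erase univ (fun i => (T i).dist (u i) (v i)) (mem_univ s)]
  have : ∑ i ∈ univ.erase s, (T i).dist (u i) (Function.update v s y i) =
      ∑ i ∈ univ.erase s, (T i).dist (u i) (v i) :=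
    sum_congr rfl fun i hi => by rw [Function.update_of_ne (mem_erase.1 hi).1]
  rw [this, Function.update_self]
  ring

lemma exists_walk_length_eq_sum_dist (hT : ∀ s, (T s).IsTree) (u w : ∀ s, V s) :
    ∃ q : (boxProdPi T).Walk u w, q.length = ∑ s, (T s).dist (u s) (w s) := by
  induction hn : ∑ s, (T s).dist (u s) (w s) generalizing w with
  | zero =>
    have : u = w := by
      funext s
      have := (sum_eq_zero_iff.1 hn) s (mem_univ s)
      exact (hT s).connected.dist_eq_zero_iff.1 this
    subst this
    exact ⟨.nil, rfl⟩
  | succ n ih =>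
    obtain ⟨s, -, hs⟩ := exists_ne_zero_of_sum_ne_zero (s := univ)
      (f := fun s => (T s).dist (u s) (w s)) (by omega)
    have hne : w s ≠ u s := by
      intro h
      rw [h, SimpleGraph.dist_self] at hs
      exact hs rfl
    have h1 := sum_dist_update_add (T := T) (u := u) (v := w) (s := s) (stepToward (T s) (u s) (w s))
    have h2 := dist_stepToward (hT s) hne
    rw [SimpleGraph.dist_comm, SimpleGraph.dist_comm (u := w s)] at h2
    obtain ⟨q, hq⟩ := ih (Function.update w s (stepToward (T s) (u s) (w s))) (by omega)
    refine ⟨q.concat (boxProdPi_adj_update (stepToward_adj (hT s) hne)).symm, ?_⟩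
    rw [SimpleGraph.Walk.length_concat, hq]

lemma sum_dist_le_length (hT : ∀ s, (T s).IsTree) {u w : ∀ s, V s}
    (q : (boxProdPi T).Walk u w) : ∑ s, (T s).dist (u s) (w s) ≤ q.length := by
  induction q with
  | nil => simp
  | @cons u u' w h q ih =>
    obtain ⟨s, hs, hne⟩ := id h
    have hu' : u' = Function.update u s (u' s) := by
      funext i
      by_cases hi : i = s
      · subst hi; simp
      · simp [hi, hne i hi]
    have h1 := sum_dist_update_add (T := T) (u := w) (v := u) (s := s) (u' s)
    rw [← hu'] at h1
    have h2 := (hT s).connected.dist_triangle (u := u s) (v := u' s) (w := w s)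
    rw [SimpleGraph.dist_eq_one_iff_adj.2 hs] at h2
    rw [SimpleGraph.Walk.length_cons]
    simp only [SimpleGraph.dist_comm (u := w _)] at h1
    omega

lemma dist_boxProdPi (hT : ∀ s, (T s).IsTree) (u w : ∀ s, V s) :
    (boxProdPi T).dist u w = ∑ s, (T s).dist (u s) (w s) := by
  obtain ⟨q, hq⟩ := exists_walk_length_eq_sum_dist hT u w
  obtain ⟨q', hq'⟩ := q.reachable.exists_walk_length_eq_dist
  refine le_antisymm (hq ▸ SimpleGraph.dist_le q) (hq' ▸ sum_dist_le_length hT q')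

lemma connected_boxProdPi (hT : ∀ s, (T s).IsTree) : (boxProdPi T).Connected := by
  have : ∀ s, Nonempty (V s) := fun s => (hT s).connected.nonempty
  exact SimpleGraph.Connected.mk fun u w =>
    (exists_walk_length_eq_sum_dist hT u w).choose.reachable

lemma mem_graphBall_boxProdPi (hT : ∀ s, (T s).IsTree) {v x : ∀ s, V s} {r : ℕ} :
    x ∈ graphBall (boxProdPi T) v r ↔ ∑ s, (T s).dist (v s) (x s) ≤ r := by
  rw [graphBall, Set.mem_ofPred_eq, ← ((connected_boxProdPi hT) v x).coe_dist_eq_edist,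
    dist_boxProdPi hT]
  norm_cast

/-- Geodesics in a product of trees correspond to lattice paths: each step of a geodesic from `u` to
`w` is a step toward `w` in one coordinate. -/
lemma ncard_walksWithin (hT : ∀ s, (T s).IsTree) (C : (∀ s, V s) → Prop) (u w : ∀ s, V s)
    (n : ℕ) (x : S → ℕ) (hx : x ≤ fun s => (T s).dist (u s) (w s))
    (hn : ∑ s, x s + n = ∑ s, (T s).dist (u s) (w s)) :
    (walksWithin (boxProdPi T) C (progressPoint T u w x) w n).Finite ∧
      (walksWithin (boxProdPi T) C (progressPoint T u w x) w n).ncard =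
        latticePaths (fun z => C (progressPoint T u w z)) (fun s => (T s).dist (u s) (w s)) n x := by
  classical
  induction n generalizing x with
  | zero =>
    have hxe : x = fun s => (T s).dist (u s) (w s) := eq_of_le_of_sum_eq hx hn
    have hpw : progressPoint T u w x = w := hxe ▸ progressPoint_dist hT u w
    have key : ∀ y, y = w → (walksWithin (boxProdPi T) C y w 0).Finite ∧
        (walksWithin (boxProdPi T) C y w 0).ncard = if C y then 1 else 0 := by
      rintro y rfl
      exact walksWithin_zero _ C y
    obtain ⟨h1, h2⟩ := key _ hpw
    refine ⟨h1, h2.trans ?_⟩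
    simp only [latticePaths]
    exact if_congr ⟨fun h => ⟨hxe, h⟩, fun h => h.2⟩ rfl rfl
  | succ n ih =>
    set c : S → ℕ := fun s => (T s).dist (u s) (w s) with hc
    set P := progressPoint T u w with hP
    simp only [latticePaths]
    by_cases hC : C (P x)
    · rw [if_pos hC]
      set F : S → Set ((boxProdPi T).Walk (P x) w) := fun s =>
        {q | ∃ (h : (boxProdPi T).Adj (P x) (P (x + Pi.single s 1)))
          (q' : (boxProdPi T).Walk (P (x + Pi.single s 1)) w),
          q' ∈ walksWithin (boxProdPi T) C (P (x + Pi.single s 1)) w n ∧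
            q = SimpleGraph.Walk.cons h q'} with hF
      have hunion : walksWithin (boxProdPi T) C (P x) w (n + 1) = ⋃ s, F s := by
        ext q
        rw [Set.mem_iUnion]
        constructor
        · rintro ⟨hlen, hsup⟩
          obtain ⟨u', h, q', rfl⟩ := exists_eq_cons_of_length_eq_succ q hlen
          rw [SimpleGraph.Walk.length_cons] at hlen
          have h0 := sum_dist_le_length hT q'
          obtain ⟨s, hs, hne⟩ := id h
          have hu' : u' = Function.update (P x) s (u' s) := by
            funext i
            by_cases hi : i = s
            · subst hi; simp
            · simp [hi, hne i hi]
          have h1 := sum_dist_update_add (T := T) (u := w) (v := P x) (s := s) (u' s)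
          rw [← hu'] at h1
          simp only [SimpleGraph.dist_comm (u := w _)] at h1
          have h2 : ∑ s, (T s).dist (P x s) (w s) + ∑ s, x s = ∑ s, (T s).dist (u s) (w s) :=
            dist_progressPoint hT hx
          have h4 : ∑ s, x s + (n + 1) = ∑ s, (T s).dist (u s) (w s) := hn
          have h3 : u' s = stepToward (T s) (w s) (P x s) :=
            eq_stepToward (hT s) hs (by omega)
          replace hu' : u' = P (x + Pi.single s 1) := by
            rw [hu', h3, hP, progressPoint_add_single]
          subst hu'
          refine ⟨s, h, q', ⟨by omega, fun y hy => hsup y ?_⟩, rfl⟩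
          rw [SimpleGraph.Walk.support_cons]
          exact List.mem_cons_of_mem _ hy
        · rintro ⟨s, h, q', hq', rfl⟩
          refine ⟨by rw [SimpleGraph.Walk.length_cons, hq'.1], fun y hy => ?_⟩
          rw [SimpleGraph.Walk.support_cons, List.mem_cons] at hy
          rcases hy with rfl | hy
          · exact hC
          · exact hq'.2 y hy
      have hcard : ∀ s, (F s).Finite ∧ (F s).ncard =
          latticePaths (fun z => C (P z)) c n (x + Pi.single s 1) := by
        intro s
        by_cases hs : x s < c s
        · have hle : x + Pi.single s 1 ≤ c := by
            intro i
            by_cases hi : i = s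
            · subst hi; simp only [Pi.add_apply, Pi.single_eq_same]; omega
            · simpa [hi] using hx i
          obtain ⟨h1, h2⟩ := ih (x + Pi.single s 1) hle (by rw [sum_add_single]; omega)
          have hne : P x s ≠ w s := by
            intro h
            have := dist_iterate_stepToward (hT s) (u s) (w s) (hx s)
            change (T s).dist (P x s) (w s) + _ = _ at this
            rw [h, SimpleGraph.dist_self] at this
            simp only [hc] at hs
            omega
          have hadj : (boxProdPi T).Adj (P x) (P (x + Pi.single s 1)) := by
            rw [hP, progressPoint_add_single]
            exact boxProdPi_adj_update (stepToward_adj (hT s) hne)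
          have himg : F s = SimpleGraph.Walk.cons hadj ''
              walksWithin (boxProdPi T) C (P (x + Pi.single s 1)) w n := by
            ext q
            constructor
            · rintro ⟨_, q', hq', rfl⟩
              exact ⟨q', hq', rfl⟩
            · rintro ⟨q', hq', rfl⟩
              exact ⟨hadj, q', hq', rfl⟩
          rw [himg]
          refine ⟨h1.image _, ?_⟩
          rw [Set.ncard_image_of_injective _ fun q₁ q₂ h => by simpa using h, h2]
        · have hxs : x s = c s := le_antisymm (hx s) (not_lt.1 hs)
          have hPs : P x s = w s := by
            rw [hP, progressPoint, hxs]
            exact iterate_stepToward_eq (hT s) _ _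
          have hPe : P (x + Pi.single s 1) = P x := by
            rw [hP, progressPoint_add_single, ← hP, hPs, stepToward_self, ← hPs,
              Function.update_eq_self]
          have hemp : F s = ∅ := by
            rw [Set.eq_empty_iff_forall_notMem]
            rintro q ⟨h, -⟩
            exact h.ne hPe.symm
          rw [hemp]
          refine ⟨Set.finite_empty, ?_⟩
          rw [Set.ncard_empty]
          by_contra h0
          have := (latticePaths_ne_zero (Ne.symm h0)).1 s
          simp only [Pi.add_apply, Pi.single_eq_same] at this
          omega
      have hdisj : Pairwise (Function.onFun Disjoint F) := by
        intro s i hsi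
        rw [Function.onFun, Set.disjoint_left]
        rintro q ⟨h, q', -, rfl⟩ ⟨h', q'', -, heq⟩
        have h1 : P (x + Pi.single s 1) = P (x + Pi.single i 1) := by
          have := congrArg (fun q => q.getVert 1) heq
          simpa using this
        apply h.ne
        funext j
        by_cases hj : j = s
        · subst hj
          rw [h1]
          exact (progressPoint_add_single_of_ne _ _ _ hsi).symm
        · exact (progressPoint_add_single_of_ne _ _ _ hj).symm
      rw [hunion]
      refine ⟨Set.finite_iUnion fun s => (hcard s).1, ?_⟩
      rw [Set.ncard_iUnion_of_finite (fun s => (hcard s).1) hdisj, finsum_eq_sum_of_fintype]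
      exact sum_congr rfl fun s _ => (hcard s).2
    · rw [if_neg hC]
      have : walksWithin (boxProdPi T) C (P x) w (n + 1) = ∅ := by
        rw [Set.eq_empty_iff_forall_notMem]
        rintro q ⟨-, hq⟩
        exact hC (hq _ q.start_mem_support)
      rw [this]
      exact ⟨Set.finite_empty, Set.ncard_empty _⟩

end Product

/-! ### Lattice paths that stay near an intermediate point -/

section LatticeBounds

variable {S : Type*} [Fintype S]

lemma sum_add_apply (a b : S → ℕ) : ∑ s, (a + b) s = ∑ s, a s + ∑ s, b s := sum_add_distrib

variable [DecidableEq S]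

/-- Paths from `0` to `a + b` that decrease the distance from `a` to half its initial value, then
move freely, and finally increase the distance from `a` never leave the ball of radius `r`
around `a`: the free middle part has length at most `r`. -/
lemma sum_le_latticePaths {ok : (S → ℕ) → Prop} {a b : S → ℕ} {r : ℕ}
    (ha : ∑ s, a s ≤ r) (hb : ∑ s, b s ≤ r)
    (hok : ∀ z ≤ a + b, ∑ s, ((a s - z s) + (z s - a s)) ≤ r → ok z) :
    ∑ a' ∈ subVectors a ((∑ s, a s) / 2), ∑ b' ∈ subVectors b ((∑ s, b s) / 2),
      wordCount (a - a') * wordCount (a' + b') * wordCount (b - b') ≤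
      latticePaths ok (a + b) (∑ s, a s + ∑ s, b s) 0 := by
  set α := ∑ s, a s with hα
  set β := ∑ s, b s with hβ
  set i := α / 2
  set j := β / 2
  have hi : i ≤ α := Nat.div_le_self _ _
  have hj : j ≤ β := Nat.div_le_self _ _
  have hij : i + j ≤ r := by omega
  have hab : ∑ s, (a + b) s = α + β := sum_add_apply a b
  -- the last two parts, starting from a point `y ≤ a` at distance `i` from `a`
  have hlast : ∀ y ∈ subVectors a (α - i), ∑ b' ∈ subVectors b j,
      wordCount (a - y + b') * wordCount (b - b') ≤ latticePaths ok (a + b) (i + β) y := by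
    intro y hy
    obtain ⟨hya, hy⟩ := mem_subVectors.1 hy
    rw [show i + β = (i + j) + (β - j) by omega, latticePaths_split]
    have hinj : Set.InjOn (fun b' : S → ℕ => a + b') (subVectors b j : Finset (S → ℕ)) :=
      fun b₁ _ b₂ _ h => add_left_cancel h
    calc _ = ∑ b' ∈ subVectors b j, latticePaths ok (a + b') (i + j) y *
          latticePaths ok (a + b) (β - j) (a + b') := by
          refine sum_congr rfl fun b' hb' => ?_
          obtain ⟨hbb, hb'⟩ := mem_subVectors.1 hb'
          rw [latticePaths_eq_wordCount, latticePaths_eq_wordCount]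
          · congr 2
            · funext s
              have : y s ≤ a s := hya s
              simp only [Pi.add_apply, Pi.sub_apply]; omega
            · funext s
              simp only [Pi.add_apply, Pi.sub_apply]; omega
          · intro z hz hz'
            refine hok z hz' (le_trans ?_ hb)
            refine sum_le_sum fun s _ => ?_
            have h1 := hz s
            have h2 := hz' s
            simp only [Pi.add_apply] at h1 h2
            omega
          · exact add_le_add_right hbb a
          · rw [sum_add_apply, hab, hb']; omega
          · intro z hz hz'
            refine hok z (hz'.trans (add_le_add_right hbb a)) (le_trans ?_ hij)
            calc _ ≤ ∑ s, ((a - y) s + b' s) := by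
                  refine sum_le_sum fun s _ => ?_
                  have h1 := hz s
                  have h2 := hz' s
                  simp only [Pi.add_apply, Pi.sub_apply] at h1 h2 ⊢
                  omega
              _ = i + j := by rw [sum_add_distrib, sum_sub_eq hya, hb', hy]; omega
          · exact hya.trans (le_add_of_nonneg_right (zero_le))
          · rw [sum_add_apply, hy, hb']; omega
      _ = ∑ z ∈ (subVectors b j).image (fun b' => a + b'), latticePaths ok z (i + j) y *
          latticePaths ok (a + b) (β - j) z :=
          (sum_image (f := fun z => latticePaths ok z (i + j) y *
            latticePaths ok (a + b) (β - j) z) hinj).symm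
      _ ≤ _ := by
          refine sum_le_sum_of_subset fun z hz => ?_
          obtain ⟨b', hb', rfl⟩ := mem_image.1 hz
          rw [mem_piAntidiag_univ, sum_add_apply, hy, (mem_subVectors.1 hb').2]
          omega
  calc _ = ∑ a' ∈ subVectors a i, (fun y => ∑ b' ∈ subVectors b j,
        wordCount y * (wordCount (a - y + b') * wordCount (b - b'))) (a - a') := by
        refine sum_congr rfl fun a' ha' => sum_congr rfl fun b' _ => ?_
        rw [tsub_tsub_cancel_of_le (mem_subVectors.1 ha').1, mul_assoc]
    _ = ∑ y ∈ subVectors a (α - i), ∑ b' ∈ subVectors b j,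
        wordCount y * (wordCount (a - y + b') * wordCount (b - b')) :=
        (sum_subVectors_sub a hi fun y => ∑ b' ∈ subVectors b j,
          wordCount y * (wordCount (a - y + b') * wordCount (b - b'))).symm
    _ ≤ ∑ y ∈ subVectors a (α - i), latticePaths ok y (α - i) 0 *
        latticePaths ok (a + b) (i + β) y := by
        refine sum_le_sum fun y hy => ?_
        rw [← mul_sum]
        obtain ⟨hya, hys⟩ := mem_subVectors.1 hy
        rw [latticePaths_eq_wordCount (y := y) (x := 0), tsub_zero]
        · exact Nat.mul_le_mul_left _ (hlast y hy)
        · intro z _ hz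
          refine hok z (hz.trans (hya.trans (le_add_of_nonneg_right (zero_le))))
            (le_trans ?_ ha)
          refine sum_le_sum fun s _ => ?_
          have h1 : z s ≤ y s := hz s
          have h2 : y s ≤ a s := hya s
          omega
        · exact zero_le
        · simp [hys]
    _ ≤ ∑ y ∈ piAntidiag univ (∑ s, (0 : S → ℕ) s + (α - i)), latticePaths ok y (α - i) 0 *
        latticePaths ok (a + b) (i + β) y := by
        refine sum_le_sum_of_subset ?_
        simpa using subVectors_subset a (α - i)
    _ = latticePaths ok (a + b) (α + β) 0 := by
        rw [← latticePaths_split]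
        congr 1
        omega

/-- The paths from `0` to `a + b` that are forced through `a` and otherwise unconstrained below
and above `a`. -/
lemma latticePaths_through {ok : (S → ℕ) → Prop} {a b : S → ℕ}
    (hdown : ∀ z ≤ a, ok z) (hup : ∀ z, a ≤ z → z ≤ a + b → ok z)
    (hthrough : ∀ z ≤ a + b, ok z → ∑ s, z s = ∑ s, a s → z = a) :
    latticePaths ok (a + b) (∑ s, a s + ∑ s, b s) 0 = wordCount a * wordCount b := by
  rw [latticePaths_split, sum_eq_single a]
  · rw [latticePaths_eq_wordCount (fun z _ hz => hdown z hz) (zero_le) (by simp),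
      latticePaths_eq_wordCount hup (le_add_of_nonneg_right (zero_le))
        (by rw [sum_add_apply])]
    simp
  · intro z hz hne
    rw [mul_eq_zero]
    right
    by_contra h0
    have hle := (latticePaths_ne_zero h0).1
    apply hne
    refine hthrough z hle ?_ (by simpa using hz)
    by_contra hnot
    apply h0
    cases (∑ s, b s) <;> simp [latticePaths, hnot]
  · intro h
    exact absurd (by simp) h

end LatticeBounds

/-! ### Geodesics in a ball -/

section Ball

variable {W : Type*} {G : SimpleGraph W}

lemma mem_graphBall (hG : G.Connected) {v x : W} {r : ℕ} :
    x ∈ graphBall G v r ↔ G.dist v x ≤ r := by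
  rw [graphBall, Set.mem_ofPred_eq, ← (hG v x).coe_dist_eq_edist]
  norm_cast

/-- Walks in an induced subgraph are the walks of the whole graph that stay in it. -/
lemma ncard_walks_induce (B : Set W) (u w : B) (Φ : G.Walk u w → Prop) :
    {q : (G.induce B).Walk u w | Φ (q.map (SimpleGraph.Embedding.induce B).toHom)}.ncard =
      {q : G.Walk u w | Φ q ∧ ∀ y ∈ q.support, y ∈ B}.ncard := by
  have hinj : Function.Injective fun q : (G.induce B).Walk u w =>
      q.map (SimpleGraph.Embedding.induce B).toHom :=
    SimpleGraph.Walk.map_injective_of_injective Subtype.val_injective u w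
  rw [← Set.ncard_image_of_injective _ hinj]
  congr 1
  ext q
  constructor
  · rintro ⟨q', hq', rfl⟩
    refine ⟨hq', fun y hy => ?_⟩
    change y ∈ (q'.map (SimpleGraph.Embedding.induce B).toHom).support at hy
    rw [SimpleGraph.Walk.support_map, List.mem_map] at hy
    obtain ⟨z, -, rfl⟩ := hy
    exact z.2
  · rintro ⟨h1, h2⟩
    refine ⟨q.induce B h2, ?_, SimpleGraph.Walk.map_induce q h2⟩
    change Φ ((q.induce B h2).map (SimpleGraph.Embedding.induce B).toHom)
    rw [SimpleGraph.Walk.map_induce q h2]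
    exact h1

lemma dist_le_dist_induce {B : Set W} {u w : B} (q : (G.induce B).Walk u w) :
    G.dist u w ≤ q.length := by
  rw [← SimpleGraph.Walk.length_map (SimpleGraph.Embedding.induce B).toHom q]
  exact SimpleGraph.dist_le _

lemma dist_getVert_of_length_eq_dist (hG : G.Connected) {u w : W} {q : G.Walk u w}
    (hq : q.length = G.dist u w) {t : ℕ} (ht : t ≤ q.length) : G.dist u (q.getVert t) = t := by
  have h1 := SimpleGraph.dist_le (q.take t)
  have h2 := SimpleGraph.dist_le (q.drop t)
  have h3 := congrArg SimpleGraph.Walk.length (q.append_take_drop_eq t)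
  rw [SimpleGraph.Walk.length_append] at h3
  rw [SimpleGraph.Walk.take_length] at h1 h3
  have h4 := hG.dist_triangle (u := u) (v := q.getVert t) (w := w)
  omega

/-- A geodesic from a point of the ball to a point between it and the centre stays in the ball. -/
lemma exists_walk_in_graphBall (hG : G.Connected) {v y : W} {r : ℕ} (u : graphBall G v r)
    (h : G.dist u y + G.dist y v = G.dist u v) :
    ∃ (hy : y ∈ graphBall G v r) (q : (G.induce (graphBall G v r)).Walk u ⟨y, hy⟩),
      q.length = G.dist u y := by
  have hu := (mem_graphBall hG).1 u.2
  obtain ⟨q, hq⟩ := hG.exists_walk_length_eq_dist u y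
  have hsup : ∀ x ∈ q.support, x ∈ graphBall G v r := by
    intro x hx
    obtain ⟨t, rfl, ht⟩ := SimpleGraph.Walk.mem_support_iff_exists_getVert.1 hx
    have h1 := SimpleGraph.dist_le (q.drop t)
    have h3 := congrArg SimpleGraph.Walk.length (q.append_take_drop_eq t)
    rw [SimpleGraph.Walk.length_append, SimpleGraph.Walk.take_length] at h3
    have h4 := hG.dist_triangle (u := q.getVert t) (v := y) (w := v)
    rw [mem_graphBall hG, SimpleGraph.dist_comm]
    rw [SimpleGraph.dist_comm] at hu
    omega
  refine ⟨hsup _ q.end_mem_support, q.induce _ hsup, ?_⟩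
  rw [← hq]
  exact (SimpleGraph.Walk.length_map _ _).symm.trans
    (congrArg SimpleGraph.Walk.length (SimpleGraph.Walk.map_induce q hsup))

/-- If the geodesics from the centre `v` to `u` and to `w` can both be chosen through `y ≠ v`, then
the way from `u` to `w` through `y` stays in the ball and is shorter than any way through `v`. -/
lemma flowThrough_center_eq_zero (hG : G.Connected) {v y : W} {r : ℕ} (u w : graphBall G v r)
    (hu : G.dist u y + G.dist y v = G.dist u v) (hw : G.dist w y + G.dist y v = G.dist w v)
    (hy : y ≠ v) :
    flowThrough (G.induce (graphBall G v r)) u w (graphBallCenter G v r) = 0 := by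
  obtain ⟨_, q₁, h₁⟩ := exists_walk_in_graphBall hG u hu
  obtain ⟨_, q₂, h₂⟩ := exists_walk_in_graphBall hG w hw
  have hd := SimpleGraph.dist_le (q₁.append q₂.reverse)
  rw [SimpleGraph.Walk.length_append, SimpleGraph.Walk.length_reverse, h₁, h₂] at hd
  have hpos := hG.pos_dist_of_ne hy
  have hemp : {q ∈ geodesics (G.induce (graphBall G v r)) u w |
      graphBallCenter G v r ∈ q.support} = ∅ := by
    classical
    rw [Set.eq_empty_iff_forall_notMem]
    rintro q ⟨hq, hv⟩
    have hq : q.length = _ := hq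
    have h3 := dist_le_dist_induce (q.takeUntil _ hv)
    have h4 := dist_le_dist_induce (q.dropUntil _ hv)
    have h5 := congrArg SimpleGraph.Walk.length (q.take_spec hv)
    rw [SimpleGraph.Walk.length_append] at h5
    change G.dist u v ≤ _ at h3
    change G.dist v w ≤ _ at h4
    rw [SimpleGraph.dist_comm] at h4
    omega
  rw [flowThrough, hemp, Set.ncard_empty, Nat.cast_zero, zero_div]

/-- If the centre `v` lies between `u` and `w`, then a geodesic runs through `v` if and only if it
is at `v` whenever it is as far from `u` as `v`. -/
lemma flowThrough_center_eq (hG : G.Connected) {v : W} {r : ℕ} (u w : graphBall G v r)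
    (h : G.dist u v + G.dist v w = G.dist u w) :
    flowThrough (G.induce (graphBall G v r)) u w (graphBallCenter G v r) =
      ((walksWithin G (fun y => y ∈ graphBall G v r ∧ (G.dist u y = G.dist u v → y = v))
        u w (G.dist u w)).ncard : ℝ) /
      ((walksWithin G (fun y => y ∈ graphBall G v r) u w (G.dist u w)).ncard : ℝ) := by
  obtain ⟨_, q₁, h₁⟩ := exists_walk_in_graphBall hG u (y := v) (by simp)
  obtain ⟨_, q₂, h₂⟩ := exists_walk_in_graphBall hG w (y := v) (by simp)
  have hdist : (G.induce (graphBall G v r)).dist u w = G.dist u w := by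
    apply le_antisymm
    · have hd := SimpleGraph.dist_le (q₁.append q₂.reverse)
      rw [SimpleGraph.Walk.length_append, SimpleGraph.Walk.length_reverse, h₁, h₂,
        SimpleGraph.dist_comm (u := (w : W)), h] at hd
      exact hd
    · obtain ⟨q, hq⟩ := (q₁.append q₂.reverse).reachable.exists_walk_length_eq_dist
      rw [← hq]
      exact dist_le_dist_induce q
  have hden : geodesics (G.induce (graphBall G v r)) u w =
      {q | (q.map (SimpleGraph.Embedding.induce (graphBall G v r)).toHom).length = G.dist u w} := by
    ext q
    rw [geodesics, Set.mem_ofPred_eq, Set.mem_ofPred_eq, SimpleGraph.Walk.length_map, hdist]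
  have hnum : {q ∈ geodesics (G.induce (graphBall G v r)) u w | graphBallCenter G v r ∈ q.support} =
      {q | (q.map (SimpleGraph.Embedding.induce (graphBall G v r)).toHom).length = G.dist u w ∧
        v ∈ (q.map (SimpleGraph.Embedding.induce (graphBall G v r)).toHom).support} := by
    ext q
    rw [hden, Set.mem_ofPred_eq, Set.mem_ofPred_eq, Set.mem_ofPred_eq]
    refine and_congr_right fun _ => ?_
    rw [SimpleGraph.Walk.support_map, List.mem_map]
    constructor
    · intro hq
      exact ⟨_, hq, rfl⟩
    · rintro ⟨x, hx, hxv⟩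
      have : x = graphBallCenter G v r := Subtype.ext hxv
      exact this ▸ hx
  rw [flowThrough, hnum, hden]
  refine congrArg₂ (fun m n : ℕ => (m : ℝ) / n)
    ((ncard_walks_induce (graphBall G v r) u w fun q =>
      q.length = G.dist u w ∧ v ∈ q.support).trans ?_)
    (ncard_walks_induce (graphBall G v r) u w fun q => q.length = G.dist u w)
  congr 1
  ext q
  simp only [walksWithin, Set.mem_ofPred_eq, and_assoc]
  refine and_congr_right fun hq => ?_
  have hle : G.dist u v ≤ q.length := by omega
  constructor
  · rintro ⟨hv, hB⟩ y hy
    refine ⟨hB y hy, fun hd => ?_⟩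
    obtain ⟨t, rfl, ht⟩ := SimpleGraph.Walk.mem_support_iff_exists_getVert.1 hy
    obtain ⟨t', hv', ht'⟩ := SimpleGraph.Walk.mem_support_iff_exists_getVert.1 hv
    rw [dist_getVert_of_length_eq_dist hG hq ht] at hd
    have h3 := dist_getVert_of_length_eq_dist hG hq ht'
    rw [hv'] at h3
    rw [hd, h3, hv']
  · intro hy
    refine ⟨?_, fun y h => (hy y h).1⟩
    have h3 := (hy _ (q.getVert_mem_support (G.dist u v))).2
      (dist_getVert_of_length_eq_dist hG hq hle)
    have h4 := q.getVert_mem_support (G.dist u v)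
    rwa [h3] at h4

end Ball

/-! ### The flow through the centre of a ball -/

section Flow

variable {S : Type*} [Fintype S] [DecidableEq S] {V : S → Type*} {T : ∀ s, SimpleGraph (V s)}

/-- No geodesic between `u` and `w` meets the centre unless the centre lies between them in every
coordinate. -/
lemma flowThrough_eq_zero_of_not_between (hT : ∀ s, (T s).IsTree) {v : ∀ s, V s} {r : ℕ}
    (u w : graphBall (boxProdPi T) v r)
    (h : ¬ ∀ s, (T s).dist (u.1 s) (w.1 s) = (T s).dist (v s) (u.1 s) + (T s).dist (v s) (w.1 s)) :
    flowThrough ((boxProdPi T).induce (graphBall (boxProdPi T) v r)) u w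
      (graphBallCenter (boxProdPi T) v r) = 0 := by
  push Not at h
  obtain ⟨s, hs⟩ := h
  obtain ⟨y, hadj, hyu, hyw⟩ :=
    (between_or_exists_common_step (hT s) (v s) (u.1 s) (w.1 s)).resolve_left hs
  have key : ∀ x : ∀ s, V s, (T s).dist y (x s) + 1 = (T s).dist (v s) (x s) →
      (boxProdPi T).dist x (Function.update v s y) + (boxProdPi T).dist (Function.update v s y) v =
        (boxProdPi T).dist x v := by
    intro x hx
    rw [SimpleGraph.dist_comm (u := Function.update v s y), dist_boxProdPi hT, dist_boxProdPi hT,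
      dist_boxProdPi hT]
    have h1 := sum_dist_update_add (T := T) (u := x) (v := v) (s := s) y
    have h2 := sum_dist_update_add (T := T) (u := v) (v := v) (s := s) y
    rw [SimpleGraph.dist_eq_one_iff_adj.2 hadj] at h2
    simp only [SimpleGraph.dist_self, sum_const_zero, add_zero, zero_add] at h2
    rw [SimpleGraph.dist_comm (v := y), SimpleGraph.dist_comm (v := v s)] at h1
    omega
  refine flowThrough_center_eq_zero (connected_boxProdPi hT) u w (key _ hyu) (key _ hyw) ?_
  intro h
  have := congr_fun h s
  rw [Function.update_self] at this
  exact hadj.ne this.symm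

/-- For a pair of vertices with the centre between them, the number of geodesics through the centre
is a product of two word counts, and the number `N` of all geodesics in the ball lies between the
number of those that descend half way to the centre, move freely and then ascend, and the number of
all geodesics of the product. -/
lemma exists_flowThrough_eq (hT : ∀ s, (T s).IsTree) {v : ∀ s, V s} {r : ℕ}
    (u w : graphBall (boxProdPi T) v r) {a b : S → ℕ} (ha : ∀ s, (T s).dist (v s) (u.1 s) = a s)
    (hb : ∀ s, (T s).dist (v s) (w.1 s) = b s)
    (h : ∀ s, (T s).dist (u.1 s) (w.1 s) = a s + b s) :
    ∃ N : ℕ, N ≤ wordCount (a + b) ∧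
      ∑ a' ∈ subVectors a ((∑ s, a s) / 2), ∑ b' ∈ subVectors b ((∑ s, b s) / 2),
        wordCount (a - a') * wordCount (a' + b') * wordCount (b - b') ≤ N ∧
      flowThrough ((boxProdPi T).induce (graphBall (boxProdPi T) v r)) u w
        (graphBallCenter (boxProdPi T) v r) = (wordCount a : ℝ) * wordCount b / N := by
  have hG := connected_boxProdPi hT
  have hc : (fun s => (T s).dist (u.1 s) (w.1 s)) = a + b := funext h
  have hur : ∑ s, a s ≤ r := by
    have := (mem_graphBall_boxProdPi hT).1 u.2
    simpa only [ha] using this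
  have hwr : ∑ s, b s ≤ r := by
    have := (mem_graphBall_boxProdPi hT).1 w.2
    simpa only [hb] using this
  have hsum : ∑ s, (T s).dist (u.1 s) (w.1 s) = ∑ s, a s + ∑ s, b s := by
    rw [← sum_add_distrib]; exact sum_congr rfl fun s _ => h s
  have hab : ∑ s, (a + b) s = ∑ s, a s + ∑ s, b s := sum_add_apply a b
  have huv : (boxProdPi T).dist u v = ∑ s, a s := by
    rw [SimpleGraph.dist_comm, dist_boxProdPi hT]; exact sum_congr rfl fun s _ => ha s
  have hvw : (boxProdPi T).dist v w = ∑ s, b s := by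
    rw [dist_boxProdPi hT]; exact sum_congr rfl fun s _ => hb s
  have huw : (boxProdPi T).dist u w = ∑ s, a s + ∑ s, b s := by
    rw [dist_boxProdPi hT]; exact hsum
  set P := progressPoint T u.1 w.1 with hP
  have hPa : P a = v := by
    funext s
    have := iterate_stepToward_of_between (hT s) (u := u.1 s) (v := v s) (w := w.1 s)
      (by rw [SimpleGraph.dist_comm, ha, hb, h])
    rw [SimpleGraph.dist_comm, ha] at this
    exact this
  have hPdist : ∀ z ≤ a + b, ∀ s, (T s).dist (u.1 s) (P z s) = z s := fun z hz s =>
    dist_self_iterate (hT s) _ _ (by rw [h]; exact hz s)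
  have hPB : ∀ z ≤ a + b, ∑ s, ((a s - z s) + (z s - a s)) ≤ r →
      P z ∈ graphBall (boxProdPi T) v r := by
    intro z _ hz
    rw [mem_graphBall_boxProdPi hT]
    refine le_trans (sum_le_sum fun s _ => ?_) hz
    rw [← hPa]
    rcases le_total (a s) (z s) with hs | hs
    · have := dist_iterate_iterate_le (hT s) (u.1 s) (w.1 s) (a s) (z s - a s)
      rw [Nat.add_sub_cancel' hs] at this
      exact this.trans (Nat.le_add_left _ _)
    · have := dist_iterate_iterate_le (hT s) (u.1 s) (w.1 s) (z s) (a s - z s)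
      rw [Nat.add_sub_cancel' hs, SimpleGraph.dist_comm] at this
      exact this.trans (Nat.le_add_right _ _)
  have hcount : ∀ C : (∀ s, V s) → Prop,
      (walksWithin (boxProdPi T) C u w (∑ s, a s + ∑ s, b s)).ncard =
        latticePaths (fun z => C (P z)) (a + b) (∑ s, a s + ∑ s, b s) 0 := by
    intro C
    have := (ncard_walksWithin hT C u.1 w.1 (∑ s, a s + ∑ s, b s) 0 (zero_le)
      (by simp [hsum])).2
    rw [hc] at this
    exact this
  refine ⟨latticePaths (fun z => P z ∈ graphBall (boxProdPi T) v r) (a + b)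
    (∑ s, a s + ∑ s, b s) 0, ?_, ?_,
    (flowThrough_center_eq hG u w (by rw [huv, hvw, huw])).trans ?_⟩
  rotate_left 2
  · rw [huw, huv, hcount, hcount, latticePaths_through]
    · push_cast
      rfl
    · intro z hz
      have hz' : z ≤ a + b := hz.trans (le_add_of_nonneg_right (zero_le))
      refine ⟨hPB z hz' (le_trans (sum_le_sum fun s _ => ?_) hur), ?_⟩
      · have : z s ≤ a s := hz s
        omega
      · rw [dist_boxProdPi hT, sum_congr rfl fun s _ => hPdist z hz' s]
        intro he
        rw [eq_of_le_of_sum_eq hz he, hPa]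
    · intro z hz hz'
      refine ⟨hPB z hz' (le_trans (sum_le_sum fun s _ => ?_) hwr), ?_⟩
      · have h1 : a s ≤ z s := hz s
        have h2 : z s ≤ a s + b s := hz' s
        omega
      · rw [dist_boxProdPi hT, sum_congr rfl fun s _ => hPdist z hz' s]
        intro he
        rw [← eq_of_le_of_sum_eq hz he.symm, hPa]
    · intro z hz hok he
      have hv := hok.2 (by rw [dist_boxProdPi hT, sum_congr rfl fun s _ => hPdist z hz s, he])
      funext s
      have := hPdist z hz s
      rw [hv, SimpleGraph.dist_comm, ha] at this
      exact this.symm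
  · have := latticePaths_le_wordCount (ok := fun z => P z ∈ graphBall (boxProdPi T) v r)
      (y := a + b) (n := ∑ s, a s + ∑ s, b s) (x := 0) (zero_le) (by rw [hab]; simp)
    rwa [tsub_zero] at this
  · exact sum_le_latticePaths hur hwr hPB

end Flow

/-! ### Summation over a ball -/

section BallSums

lemma finsum_mem_ne_eq_sum {W : Type*} {B : Set W} {s : Finset W} (hs : ∀ x, x ∈ s ↔ x ∈ B)
    (φ : B × B → ℝ) (F : W → W → ℝ) (hF : ∀ u w : B, u ≠ w → F u w = φ (u, w))
    (hF0 : ∀ u, F u u = 0) :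
    ∑ᶠ e ∈ {e : B × B | e.1 ≠ e.2}, φ e = ∑ u ∈ s, ∑ w ∈ s, F u w := by
  classical
  have hinj : Set.InjOn (fun e : B × B => ((e.1 : W), (e.2 : W))) {e : B × B | e.1 ≠ e.2} := by
    rintro ⟨a, b⟩ - ⟨a', b'⟩ - h
    simp only [Prod.mk.injEq] at h
    rw [Subtype.ext h.1, Subtype.ext h.2]
  have himg : (fun e : B × B => ((e.1 : W), (e.2 : W))) '' {e : B × B | e.1 ≠ e.2} =
      (s.offDiag : Set (W × W)) := by
    ext ⟨u, w⟩
    simp only [Set.mem_image, Prod.exists, mem_coe, mem_offDiag, Prod.mk.injEq, hs]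
    constructor
    · rintro ⟨a, b, hab, rfl, rfl⟩
      exact ⟨a.2, b.2, fun h => hab (Subtype.ext h)⟩
    · rintro ⟨hu, hw, hne⟩
      exact ⟨⟨u, hu⟩, ⟨w, hw⟩, fun h => hne (congrArg Subtype.val h), rfl, rfl⟩
  calc ∑ᶠ e ∈ {e : B × B | e.1 ≠ e.2}, φ e =
        ∑ᶠ e ∈ {e : B × B | e.1 ≠ e.2}, (fun p : W × W => F p.1 p.2) ((e.1 : W), (e.2 : W)) :=
        finsum_mem_congr rfl fun e he => (hF e.1 e.2 he).symm
    _ = ∑ p ∈ s.offDiag, F p.1 p.2 := by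
        rw [← finsum_mem_image (f := fun p : W × W => F p.1 p.2) hinj, himg,
          finsum_mem_coe_finset]
    _ = ∑ p ∈ s ×ˢ s, F p.1 p.2 := by
        refine sum_subset (fun p hp => ?_) fun p hp hp' => ?_
        · rw [mem_offDiag] at hp
          exact mem_product.2 ⟨hp.1, hp.2.1⟩
        · rw [mem_product] at hp
          have : p.1 = p.2 := by
            by_contra h
            exact hp' (mem_offDiag.2 ⟨hp.1, hp.2, h⟩)
          rw [this, hF0]
    _ = _ := sum_product _ _ _

variable {S : Type*}

variable {q : S → ℕ} {Q : ℕ}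

/-- The branching numbers of the factors relative to the largest one. -/
noncomputable def relativeBranching {S : Type*} (q : S → ℕ) (Q : ℕ) (s : S) : ℝ := (q s : ℝ) / Q

lemma relativeBranching_nonneg (s : S) : 0 ≤ relativeBranching q Q s := by
  unfold relativeBranching; positivity

variable [Fintype S]

lemma prod_pow_eq (hQ : Q ≠ 0) (a : S → ℕ) :
    ∏ s, (q s : ℝ) ^ a s = (Q : ℝ) ^ (∑ s, a s) * monomialAt (relativeBranching q Q) a := by
  rw [monomialAt, ← prod_pow_eq_pow_sum, ← prod_mul_distrib]
  refine prod_congr rfl fun s _ => ?_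
  have : (Q : ℝ) ≠ 0 := by exact_mod_cast hQ
  rw [relativeBranching, ← mul_pow, mul_div_cancel₀ _ this]

variable [DecidableEq S] {V : S → Type*} {T : ∀ s, SimpleGraph (V s)}
  [∀ s, (T s).LocallyFinite]

/-- The vertices of the product whose coordinates have the prescribed distances `a` from `v`. -/
noncomputable def shell (T : ∀ s, SimpleGraph (V s)) [∀ s, (T s).LocallyFinite] (v : ∀ s, V s)
    (a : S → ℕ) : Finset (∀ s, V s) :=
  Fintype.piFinset fun s => sphereFinset (T s) (v s) (a s)

/-- The vertices of the product whose coordinates have the prescribed distances `b` from `v` and lie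
opposite to those of `u`. -/
noncomputable def oppositeShell (T : ∀ s, SimpleGraph (V s)) [∀ s, (T s).LocallyFinite]
    (v u : ∀ s, V s) (b : S → ℕ) : Finset (∀ s, V s) :=
  Fintype.piFinset fun s => oppositeFinset (T s) (v s) (u s) (b s)

open scoped Classical in
/-- The ball of radius `r` around `v`, as a finite set. -/
noncomputable def ballFinset (T : ∀ s, SimpleGraph (V s)) [∀ s, (T s).LocallyFinite]
    (v : ∀ s, V s) (r : ℕ) : Finset (∀ s, V s) :=
  (range (r + 1)).biUnion fun n => (piAntidiag univ n).biUnion (shell T v)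

lemma mem_shell (hT : ∀ s, (T s).IsTree) {v u : ∀ s, V s} {a : S → ℕ} :
    u ∈ shell T v a ↔ ∀ s, (T s).dist (v s) (u s) = a s := by
  simp only [shell, Fintype.mem_piFinset, mem_sphereFinset (hT _)]

lemma mem_oppositeShell (hT : ∀ s, (T s).IsTree) {v u w : ∀ s, V s} {b : S → ℕ} :
    w ∈ oppositeShell T v u b ↔ ∀ s, (T s).dist (v s) (w s) = b s ∧
      (T s).dist (w s) (u s) = b s + (T s).dist (v s) (u s) := by
  simp only [oppositeShell, Fintype.mem_piFinset, mem_oppositeFinset (hT _)]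

lemma mem_ballFinset (hT : ∀ s, (T s).IsTree) {v u : ∀ s, V s} {r : ℕ} :
    u ∈ ballFinset T v r ↔ u ∈ graphBall (boxProdPi T) v r := by
  simp only [ballFinset, mem_biUnion, mem_range, mem_piAntidiag_univ, mem_shell hT,
    mem_graphBall_boxProdPi hT]
  constructor
  · rintro ⟨n, hn, a, ha, hu⟩
    have : ∑ s, (T s).dist (v s) (u s) = ∑ s, a s := sum_congr rfl fun s _ => hu s
    omega
  · intro h
    exact ⟨_, by omega, _, rfl, fun s => rfl⟩

lemma sum_ballFinset (hT : ∀ s, (T s).IsTree) (v : ∀ s, V s) (r : ℕ) (f : (∀ s, V s) → ℝ) :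
    ∑ u ∈ ballFinset T v r, f u =
      ∑ n ∈ range (r + 1), ∑ a ∈ piAntidiag univ n, ∑ u ∈ shell T v a, f u := by
  classical
  have hdisj : ∀ a b : S → ℕ, a ≠ b → Disjoint (shell T v a) (shell T v b) := by
    intro a b hab
    rw [disjoint_left]
    intro u ha hb
    rw [mem_shell hT] at ha hb
    exact hab (funext fun s => (ha s).symm.trans (hb s))
  rw [ballFinset, sum_biUnion]
  · refine sum_congr rfl fun n _ => ?_
    rw [sum_biUnion]
    exact fun a _ b _ hab => hdisj a b hab
  · intro m _ n _ hmn
    rw [Function.onFun, disjoint_biUnion_left]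
    intro a ha
    rw [disjoint_biUnion_right]
    intro b hb
    refine hdisj a b ?_
    rintro rfl
    exact hmn ((mem_piAntidiag_univ.1 ha).symm.trans (mem_piAntidiag_univ.1 hb))

lemma card_shell_le (hT : ∀ s, (T s).IsTree) (hq : ∀ s, 1 ≤ q s)
    (hreg : ∀ s, (T s).IsRegularOfDegree (q s + 1)) (hQ : Q ≠ 0) (v : ∀ s, V s) (a : S → ℕ) :
    (#(shell T v a) : ℝ) ≤ 2 ^ Fintype.card S *
      ((Q : ℝ) ^ (∑ s, a s) * monomialAt (relativeBranching q Q) a) := by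
  rw [← prod_pow_eq hQ, shell, Fintype.card_piFinset, ← card_univ, ← prod_const,
    ← prod_mul_distrib]
  push_cast
  refine prod_le_prod (fun s _ => Nat.cast_nonneg _) fun s _ => ?_
  exact_mod_cast card_sphereFinset_le (hT s) (hq s) (hreg s) (v s) (a s)

lemma le_card_shell (hT : ∀ s, (T s).IsTree)
    (hreg : ∀ s, (T s).IsRegularOfDegree (q s + 1)) (hQ : Q ≠ 0) (v : ∀ s, V s) (a : S → ℕ) :
    (Q : ℝ) ^ (∑ s, a s) * monomialAt (relativeBranching q Q) a ≤ #(shell T v a) := by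
  rw [← prod_pow_eq hQ, shell, Fintype.card_piFinset]
  push_cast
  refine prod_le_prod (fun s _ => by positivity) fun s _ => ?_
  exact_mod_cast pow_le_card_sphereFinset (hT s) (hreg s) (v s) (a s)

lemma le_card_oppositeShell (hT : ∀ s, (T s).IsTree)
    (hreg : ∀ s, (T s).IsRegularOfDegree (q s + 1)) (hQ : Q ≠ 0) (v u : ∀ s, V s) (b : S → ℕ) :
    (Q : ℝ) ^ (∑ s, b s) * monomialAt (relativeBranching q Q) b ≤ #(oppositeShell T v u b) := by
  rw [← prod_pow_eq hQ, oppositeShell, Fintype.card_piFinset]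
  push_cast
  refine prod_le_prod (fun s _ => by positivity) fun s _ => ?_
  exact_mod_cast pow_le_card_oppositeFinset (hT s) (hreg s) (v s) (u s) (b s)

lemma sum_pow_range_le (hQ : 2 ≤ Q) (r : ℕ) :
    ∑ n ∈ range (r + 1), (Q : ℝ) ^ n ≤ 2 * (Q : ℝ) ^ r := by
  have hQ' : (2 : ℝ) ≤ Q := by exact_mod_cast hQ
  induction r with
  | zero => simp
  | succ r ih =>
    rw [sum_range_succ]
    have : (0 : ℝ) ≤ (Q : ℝ) ^ r := by positivity
    rw [pow_succ]
    nlinarith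

lemma halvesAverage_nonneg (a b : S → ℕ) : 0 ≤ halvesAverage a b :=
  sum_nonneg fun _ _ => sum_nonneg fun _ _ =>
    mul_nonneg (mul_nonneg (hypergeom_nonneg _ _) (hypergeom_nonneg _ _)) (splitRatio_nonneg _ _)

lemma subVectors_nonempty (a : S → ℕ) {i : ℕ} (hi : i ≤ ∑ s, a s) : (subVectors a i).Nonempty := by
  by_contra h
  rw [not_nonempty_iff_eq_empty] at h
  have := wordCount_split a hi
  rw [h, sum_empty] at this
  exact (wordCount_pos a).ne' this

lemma flowThrough_nonneg {W : Type*} (G : SimpleGraph W) (u w v : W) :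
    0 ≤ flowThrough G u w v := by
  unfold flowThrough; positivity

lemma flowThrough_le_halvesAverage (hT : ∀ s, (T s).IsTree) {v : ∀ s, V s} {r : ℕ}
    (u w : graphBall (boxProdPi T) v r) {a b : S → ℕ} (ha : u.1 ∈ shell T v a)
    (hb : w.1 ∈ shell T v b) :
    flowThrough ((boxProdPi T).induce (graphBall (boxProdPi T) v r)) u w
      (graphBallCenter (boxProdPi T) v r) ≤ halvesAverage a b := by
  rw [mem_shell hT] at ha hb
  by_cases h : ∀ s, (T s).dist (u.1 s) (w.1 s) =
      (T s).dist (v s) (u.1 s) + (T s).dist (v s) (w.1 s)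
  · obtain ⟨N, -, hN, hflow⟩ := exists_flowThrough_eq hT u w ha hb
      (fun s => by rw [h, ha, hb])
    rw [hflow]
    exact div_le_halvesAverage a b N (by exact_mod_cast hN)
  · rw [flowThrough_eq_zero_of_not_between hT u w h]
    exact halvesAverage_nonneg a b

lemma splitRatio_le_flowThrough (hT : ∀ s, (T s).IsTree) {v : ∀ s, V s} {r : ℕ}
    (u w : graphBall (boxProdPi T) v r) {a b : S → ℕ} (ha : u.1 ∈ shell T v a)
    (hb : w.1 ∈ oppositeShell T v u b) :
    splitRatio a b ≤ flowThrough ((boxProdPi T).induce (graphBall (boxProdPi T) v r)) u w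
      (graphBallCenter (boxProdPi T) v r) := by
  rw [mem_shell hT] at ha
  rw [mem_oppositeShell hT] at hb
  obtain ⟨N, hN, hN', hflow⟩ := exists_flowThrough_eq hT u w ha (fun s => (hb s).1)
    (fun s => by rw [SimpleGraph.dist_comm, (hb s).2, ha, add_comm])
  rw [hflow, splitRatio]
  have hNpos : 0 < N := by
    refine lt_of_lt_of_le ?_ hN'
    obtain ⟨a', ha'⟩ := subVectors_nonempty a (Nat.div_le_self (∑ s, a s) 2)
    obtain ⟨b', hb'⟩ := subVectors_nonempty b (Nat.div_le_self (∑ s, b s) 2)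
    exact sum_pos (fun _ _ => sum_pos (fun _ _ => Nat.mul_pos (Nat.mul_pos (wordCount_pos _)
      (wordCount_pos _)) (wordCount_pos _)) ⟨b', hb'⟩) ⟨a', ha'⟩
  have h1 : (0 : ℝ) < N := by exact_mod_cast hNpos
  have h2 : (N : ℝ) ≤ wordCount (a + b) := by exact_mod_cast hN
  exact div_le_div_of_nonneg_left (by positivity) h1 h2

end BallSums

/-! ### The size of a ball and the load at its centre -/

section Estimates

variable {S : Type*} [Fintype S] [DecidableEq S] {V : S → Type*} {T : ∀ s, SimpleGraph (V s)}
  [∀ s, (T s).LocallyFinite] {q : S → ℕ} {Q : ℕ}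

lemma card_ballFinset_eq (hT : ∀ s, (T s).IsTree) (v : ∀ s, V s) (r : ℕ) :
    (#(ballFinset T v r) : ℝ) =
      ∑ n ∈ range (r + 1), ∑ a ∈ piAntidiag univ n, (#(shell T v a) : ℝ) := by
  have := sum_ballFinset hT v r fun _ => 1
  simpa using this

lemma card_ballFinset_le (hT : ∀ s, (T s).IsTree) (hq : ∀ s, 1 ≤ q s)
    (hreg : ∀ s, (T s).IsRegularOfDegree (q s + 1)) (hQ : 2 ≤ Q) (v : ∀ s, V s) {r e : ℕ} {C : ℝ}
    (hC : 0 < C)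
    (hA : ∀ n : ℕ, completeHomogeneous (relativeBranching q Q) n ≤ C * ((n : ℝ) + 1) ^ e) :
    (#(ballFinset T v r) : ℝ) ≤
      2 ^ Fintype.card S * C * 2 * ((Q : ℝ) ^ r * ((r : ℝ) + 1) ^ e) := by
  rw [card_ballFinset_eq hT]
  calc _ ≤ ∑ n ∈ range (r + 1), (Q : ℝ) ^ n * (2 ^ Fintype.card S * C * ((r : ℝ) + 1) ^ e) := by
        refine sum_le_sum fun n hn => ?_
        have hnr : (n : ℝ) ≤ r := by
          exact_mod_cast Nat.lt_succ_iff.1 (mem_range.1 hn)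
        calc _ ≤ ∑ a ∈ piAntidiag univ n, 2 ^ Fintype.card S *
              ((Q : ℝ) ^ n * monomialAt (relativeBranching q Q) a) := by
              refine sum_le_sum fun a ha => ?_
              have := card_shell_le hT hq hreg (by omega) v a (Q := Q)
              rwa [mem_piAntidiag_univ.1 ha] at this
          _ = 2 ^ Fintype.card S * (Q : ℝ) ^ n *
              completeHomogeneous (relativeBranching q Q) n := by
              rw [completeHomogeneous, mul_sum]
              exact sum_congr rfl fun a _ => by ring
          _ ≤ 2 ^ Fintype.card S * (Q : ℝ) ^ n * (C * ((r : ℝ) + 1) ^ e) := by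
              gcongr
              refine (hA n).trans ?_
              gcongr
          _ = _ := by ring
    _ = (∑ n ∈ range (r + 1), (Q : ℝ) ^ n) * (2 ^ Fintype.card S * C * ((r : ℝ) + 1) ^ e) := by
        rw [sum_mul]
    _ ≤ (2 * (Q : ℝ) ^ r) * (2 ^ Fintype.card S * C * ((r : ℝ) + 1) ^ e) := by
        gcongr
        exact sum_pow_range_le hQ r
    _ = _ := by ring

lemma le_card_ballFinset (hT : ∀ s, (T s).IsTree)
    (hreg : ∀ s, (T s).IsRegularOfDegree (q s + 1)) (hQ : Q ≠ 0) (v : ∀ s, V s) (r : ℕ) :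
    (Q : ℝ) ^ r * completeHomogeneous (relativeBranching q Q) r ≤ #(ballFinset T v r) := by
  rw [card_ballFinset_eq hT]
  calc _ = ∑ a ∈ piAntidiag univ r, (Q : ℝ) ^ r * monomialAt (relativeBranching q Q) a := by
        rw [completeHomogeneous, mul_sum]
    _ ≤ ∑ a ∈ piAntidiag univ r, (#(shell T v a) : ℝ) := by
        refine sum_le_sum fun a ha => ?_
        have := le_card_shell hT hreg hQ v a
        rwa [mem_piAntidiag_univ.1 ha] at this
    _ ≤ _ := single_le_sum (f := fun n => ∑ a ∈ piAntidiag univ n, (#(shell T v a) : ℝ))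
        (fun n _ => sum_nonneg fun a _ => Nat.cast_nonneg _) (self_mem_range_succ r)

lemma one_le_completeHomogeneous {ρ : S → ℝ} (hρ : ∀ s, 0 ≤ ρ s) {s₀ : S} (h₀ : ρ s₀ = 1) (n : ℕ) :
    1 ≤ completeHomogeneous ρ n := by
  have h : monomialAt ρ (Pi.single s₀ n) = 1 := by
    refine prod_eq_one fun s _ => ?_
    by_cases hs : s = s₀
    · subst hs; simp [h₀]
    · simp [hs]
  rw [← h]
  exact single_le_sum (f := monomialAt ρ) (fun c _ => monomialAt_nonneg hρ c)
    (mem_piAntidiag_univ.2 (by simp))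

/-- The traffic load at the centre of a ball as a sum over all ordered pairs of vertices of the
product that lie in the ball. -/
lemma exists_trafficLoad_eq (hT : ∀ s, (T s).IsTree) (v : ∀ s, V s) (r : ℕ) :
    ∃ F : (∀ s, V s) → (∀ s, V s) → ℝ, (∀ u w, 0 ≤ F u w) ∧
      (∀ u w : graphBall (boxProdPi T) v r, F u w ≤
        flowThrough ((boxProdPi T).induce (graphBall (boxProdPi T) v r)) u w
          (graphBallCenter (boxProdPi T) v r)) ∧
      (∀ u w : graphBall (boxProdPi T) v r, u ≠ w → F u w =
        flowThrough ((boxProdPi T).induce (graphBall (boxProdPi T) v r)) u w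
          (graphBallCenter (boxProdPi T) v r)) ∧
      trafficLoad ((boxProdPi T).induce (graphBall (boxProdPi T) v r))
        (graphBallCenter (boxProdPi T) v r) =
          (1 / 2) * ∑ u ∈ ballFinset T v r, ∑ w ∈ ballFinset T v r, F u w := by
  classical
  set F : (∀ s, V s) → (∀ s, V s) → ℝ := fun u w =>
    if h : (u ∈ graphBall (boxProdPi T) v r ∧ w ∈ graphBall (boxProdPi T) v r) ∧ u ≠ w then
      flowThrough ((boxProdPi T).induce (graphBall (boxProdPi T) v r)) ⟨u, h.1.1⟩ ⟨w, h.1.2⟩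
        (graphBallCenter (boxProdPi T) v r) else 0 with hF
  have hne : ∀ u w : graphBall (boxProdPi T) v r, u ≠ w → F u w =
      flowThrough ((boxProdPi T).induce (graphBall (boxProdPi T) v r)) u w
        (graphBallCenter (boxProdPi T) v r) := fun u w h => by
    simp only [hF]
    rw [dif_pos ⟨⟨u.2, w.2⟩, fun h' => h (Subtype.ext h')⟩]
  refine ⟨F, fun u w => ?_, fun u w => ?_, hne, ?_⟩
  · simp only [hF]
    split_ifs
    · exact flowThrough_nonneg _ _ _ _
    · exact le_rfl
  · by_cases h : u = w
    · subst h
      simp only [hF, ne_eq, not_true_eq_false, and_false, dite_false]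
      exact flowThrough_nonneg _ _ _ _
    · exact (hne u w h).le
  · rw [trafficLoad, finsum_mem_ne_eq_sum (s := ballFinset T v r) (fun x => mem_ballFinset hT)
      _ F hne (fun u => by simp [hF])]

lemma trafficLoad_le [Nonempty S] (hT : ∀ s, (T s).IsTree) (hq : ∀ s, 1 ≤ q s) (hqQ : ∀ s, q s ≤ Q)
    (hreg : ∀ s, (T s).IsRegularOfDegree (q s + 1)) (hQ : 2 ≤ Q) (v : ∀ s, V s) {r e : ℕ} {C : ℝ}
    (hC : 0 < C)
    (hA : ∀ n : ℕ, completeHomogeneous (relativeBranching q Q) n ≤ C * ((n : ℝ) + 1) ^ e) :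
    trafficLoad ((boxProdPi T).induce (graphBall (boxProdPi T) v r))
      (graphBallCenter (boxProdPi T) v r) ≤
      ((2 ^ Fintype.card S) ^ 4 * C * 4) * ((Q : ℝ) ^ (2 * r) * ((r : ℝ) + 1) ^ e) := by
  obtain ⟨F, hF0, hF, -, hL⟩ := exists_trafficLoad_eq hT v r
  set ρ := relativeBranching q Q with hρdef
  set K : ℝ := 2 ^ Fintype.card S
  have hK : 0 < K := by positivity
  have hQ0 : Q ≠ 0 := by omega
  have hQpos : (0 : ℝ) < Q := by exact_mod_cast Nat.pos_of_ne_zero hQ0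
  have hρ : ∀ s, 0 ≤ ρ s := relativeBranching_nonneg
  have hρ1 : ∀ s, ρ s ≤ 1 := fun s => by
    rw [hρdef, relativeBranching, div_le_one hQpos]
    exact_mod_cast hqQ s
  have hmem : ∀ n ∈ range (r + 1), ∀ a ∈ piAntidiag univ n, ∀ u ∈ shell T v a,
      u ∈ graphBall (boxProdPi T) v r := by
    intro n hn a ha u hu
    rw [mem_graphBall_boxProdPi hT]
    rw [mem_shell hT] at hu
    have : ∑ s, (T s).dist (v s) (u s) = ∑ s, a s := sum_congr rfl fun s _ => hu s
    have := mem_piAntidiag_univ.1 ha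
    have := mem_range.1 hn
    omega
  have hsum : ∑ u ∈ ballFinset T v r, ∑ w ∈ ballFinset T v r, F u w ≤
      ∑ m ∈ range (r + 1), ∑ n ∈ range (r + 1), K ^ 2 * ((Q : ℝ) ^ m * (Q : ℝ) ^ n) *
        (K ^ 2 * (C * ((r : ℝ) + 1) ^ e)) := by
    calc _ ≤ ∑ m ∈ range (r + 1), ∑ a ∈ piAntidiag univ m, ∑ u ∈ shell T v a,
          ∑ n ∈ range (r + 1), ∑ b ∈ piAntidiag univ n, ∑ w ∈ shell T v b, halvesAverage a b := by
          rw [sum_ballFinset hT]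
          refine sum_le_sum fun m hm => sum_le_sum fun a ha => sum_le_sum fun u hu => ?_
          rw [sum_ballFinset hT]
          refine sum_le_sum fun n hn => sum_le_sum fun b hb => sum_le_sum fun w hw => ?_
          exact (hF ⟨u, hmem m hm a ha u hu⟩ ⟨w, hmem n hn b hb w hw⟩).trans
            (flowThrough_le_halvesAverage hT _ _ hu hw)
      _ = ∑ m ∈ range (r + 1), ∑ n ∈ range (r + 1), ∑ a ∈ piAntidiag univ m,
          ∑ b ∈ piAntidiag univ n, (#(shell T v a) : ℝ) * (#(shell T v b) * halvesAverage a b) := by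
          refine sum_congr rfl fun m _ => ?_
          rw [sum_comm]
          refine sum_congr rfl fun a _ => ?_
          simp only [sum_const, nsmul_eq_mul, mul_sum]
      _ ≤ _ := by
          refine sum_le_sum fun m hm => sum_le_sum fun n hn => ?_
          have hmr := mem_range.1 hm
          have hnr := mem_range.1 hn
          calc _ ≤ ∑ a ∈ piAntidiag univ m, ∑ b ∈ piAntidiag univ n,
                K ^ 2 * ((Q : ℝ) ^ m * (Q : ℝ) ^ n) *
                  (monomialAt ρ a * monomialAt ρ b * halvesAverage a b) := by
                refine sum_le_sum fun a ha => sum_le_sum fun b hb => ?_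
                have h1 := card_shell_le hT hq hreg hQ0 v a
                have h2 := card_shell_le hT hq hreg hQ0 v b
                rw [mem_piAntidiag_univ.1 ha] at h1
                rw [mem_piAntidiag_univ.1 hb] at h2
                have h3 := mul_le_mul h1 h2 (Nat.cast_nonneg _) (le_trans (Nat.cast_nonneg _) h1)
                have h4 := mul_le_mul_of_nonneg_right h3 (halvesAverage_nonneg a b)
                rw [mul_assoc] at h4
                refine h4.trans (le_of_eq ?_)
                change K * ((Q : ℝ) ^ m * monomialAt ρ a) * (K * ((Q : ℝ) ^ n * monomialAt ρ b)) *
                  halvesAverage a b = _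
                ring
            _ = K ^ 2 * ((Q : ℝ) ^ m * (Q : ℝ) ^ n) * ∑ a ∈ piAntidiag univ m,
                ∑ b ∈ piAntidiag univ n, monomialAt ρ a * monomialAt ρ b * halvesAverage a b := by
                simp only [mul_sum]
            _ ≤ K ^ 2 * ((Q : ℝ) ^ m * (Q : ℝ) ^ n) *
                (K ^ 2 * completeHomogeneous ρ (m / 2 + n / 2)) := by
                gcongr
                exact sum_monomialAt_halvesAverage_le hρ hρ1 m n
            _ ≤ _ := by
                gcongr
                refine (hA _).trans ?_
                gcongr
                have : m / 2 + n / 2 ≤ r := by omega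
                exact_mod_cast this
  rw [hL]
  have hgeo := sum_pow_range_le hQ r
  have hgeo0 : 0 ≤ ∑ n ∈ range (r + 1), (Q : ℝ) ^ n := sum_nonneg fun _ _ => by positivity
  calc _ ≤ 1 * ∑ u ∈ ballFinset T v r, ∑ w ∈ ballFinset T v r, F u w := by
        refine mul_le_mul_of_nonneg_right (by norm_num) ?_
        exact sum_nonneg fun _ _ => sum_nonneg fun _ _ => hF0 _ _
    _ ≤ ∑ m ∈ range (r + 1), ∑ n ∈ range (r + 1), K ^ 2 * ((Q : ℝ) ^ m * (Q : ℝ) ^ n) *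
        (K ^ 2 * (C * ((r : ℝ) + 1) ^ e)) := by rw [one_mul]; exact hsum
    _ = K ^ 4 * C * ((r : ℝ) + 1) ^ e *
        ((∑ m ∈ range (r + 1), (Q : ℝ) ^ m) * ∑ n ∈ range (r + 1), (Q : ℝ) ^ n) := by
        rw [sum_mul_sum]
        simp only [mul_sum]
        exact sum_congr rfl fun m _ => sum_congr rfl fun n _ => by ring
    _ ≤ K ^ 4 * C * ((r : ℝ) + 1) ^ e * ((2 * (Q : ℝ) ^ r) * (2 * (Q : ℝ) ^ r)) := by
        gcongr
    _ = _ := by ring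

lemma le_trafficLoad (hT : ∀ s, (T s).IsTree)
    (hreg : ∀ s, (T s).IsRegularOfDegree (q s + 1)) (hQ : Q ≠ 0) (v : ∀ s, V s) {r : ℕ}
    (hr : 1 ≤ r) :
    (1 / 2) * ((Q : ℝ) ^ (2 * r) * completeHomogeneous (relativeBranching q Q) (r + r)) ≤
      trafficLoad ((boxProdPi T).induce (graphBall (boxProdPi T) v r))
        (graphBallCenter (boxProdPi T) v r) := by
  obtain ⟨F, hF0, -, hF, hL⟩ := exists_trafficLoad_eq hT v r
  set ρ := relativeBranching q Q
  have hρ : ∀ s, 0 ≤ ρ s := relativeBranching_nonneg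
  rw [hL]
  refine mul_le_mul_of_nonneg_left ?_ (by norm_num)
  -- only pairs of vertices on the boundary of the ball with the centre between them are counted
  have hsub : ∀ u b, oppositeShell T v u b ⊆ shell T v b := by
    intro u b w hw
    rw [mem_oppositeShell hT] at hw
    rw [mem_shell hT]
    exact fun s => (hw s).1
  have hmem : ∀ a ∈ piAntidiag univ r, ∀ u ∈ shell T v a, u ∈ graphBall (boxProdPi T) v r := by
    intro a ha u hu
    rw [mem_graphBall_boxProdPi hT]
    rw [mem_shell hT] at hu
    have : ∑ s, (T s).dist (v s) (u s) = ∑ s, a s := sum_congr rfl fun s _ => hu s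
    have := mem_piAntidiag_univ.1 ha
    omega
  have hpair : ∀ a ∈ piAntidiag univ r, ∀ u ∈ shell T v a, ∀ b ∈ piAntidiag univ r,
      ∀ w ∈ oppositeShell T v u b, splitRatio a b ≤ F u w := by
    intro a ha u hu b hb w hw
    have hne : u ≠ w := by
      rintro rfl
      rw [mem_oppositeShell hT] at hw
      have hb0 : ∑ s, b s = 0 := sum_eq_zero fun s _ => by
        have := (hw s).2
        rw [SimpleGraph.dist_self] at this
        omega
      rw [mem_piAntidiag_univ] at hb
      omega
    have h1 := splitRatio_le_flowThrough hT ⟨u, hmem a ha u hu⟩ ⟨w, hmem b hb w (hsub u b hw)⟩ hu hw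
    rwa [← hF _ _ fun h => hne (congrArg Subtype.val h)] at h1
  calc (Q : ℝ) ^ (2 * r) * completeHomogeneous ρ (r + r) =
        ∑ a ∈ piAntidiag univ r, ∑ b ∈ piAntidiag univ r,
          ((Q : ℝ) ^ r * monomialAt ρ a) * (((Q : ℝ) ^ r * monomialAt ρ b) * splitRatio a b) := by
        rw [← sum_monomialAt_splitRatio, mul_sum]
        refine sum_congr rfl fun a _ => ?_
        rw [mul_sum]
        exact sum_congr rfl fun b _ => by ring
    _ ≤ ∑ a ∈ piAntidiag univ r, ∑ u ∈ shell T v a, ∑ b ∈ piAntidiag univ r,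
          ∑ w ∈ oppositeShell T v u b, splitRatio a b := by
        refine sum_le_sum fun a ha => ?_
        have h1 := le_card_shell hT hreg hQ v a
        rw [mem_piAntidiag_univ.1 ha] at h1
        calc _ = ((Q : ℝ) ^ r * monomialAt ρ a) * ∑ b ∈ piAntidiag univ r,
              ((Q : ℝ) ^ r * monomialAt ρ b) * splitRatio a b := (mul_sum _ _ _).symm
          _ ≤ (#(shell T v a) : ℝ) * ∑ b ∈ piAntidiag univ r,
              ((Q : ℝ) ^ r * monomialAt ρ b) * splitRatio a b := by
              refine mul_le_mul_of_nonneg_right h1 (sum_nonneg fun b _ => ?_)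
              exact mul_nonneg (mul_nonneg (by positivity) (monomialAt_nonneg hρ b))
                (splitRatio_nonneg _ _)
          _ = ∑ u ∈ shell T v a, ∑ b ∈ piAntidiag univ r,
              ((Q : ℝ) ^ r * monomialAt ρ b) * splitRatio a b := by
              rw [sum_const, nsmul_eq_mul]
          _ ≤ _ := by
              refine sum_le_sum fun u _ => sum_le_sum fun b hb => ?_
              have h2 := le_card_oppositeShell hT hreg hQ v u b
              rw [mem_piAntidiag_univ.1 hb] at h2
              rw [sum_const, nsmul_eq_mul]
              exact mul_le_mul_of_nonneg_right h2 (splitRatio_nonneg _ _)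
    _ ≤ ∑ a ∈ piAntidiag univ r, ∑ u ∈ shell T v a, ∑ b ∈ piAntidiag univ r,
          ∑ w ∈ shell T v b, F u w := by
        refine sum_le_sum fun a ha => sum_le_sum fun u hu => sum_le_sum fun b hb => ?_
        refine (sum_le_sum fun w hw => hpair a ha u hu b hb w hw).trans ?_
        exact sum_le_sum_of_subset_of_nonneg (hsub u b) fun w _ _ => hF0 u w
    _ ≤ ∑ a ∈ piAntidiag univ r, ∑ u ∈ shell T v a, ∑ w ∈ ballFinset T v r, F u w := by
        refine sum_le_sum fun a _ => sum_le_sum fun u _ => ?_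
        rw [sum_ballFinset hT]
        exact single_le_sum (f := fun n => ∑ b ∈ piAntidiag univ n, ∑ w ∈ shell T v b, F u w)
          (fun n _ => sum_nonneg fun _ _ => sum_nonneg fun w _ => hF0 u w) (self_mem_range_succ r)
    _ ≤ _ := by
        rw [sum_ballFinset hT]
        exact single_le_sum (f := fun n => ∑ a ∈ piAntidiag univ n, ∑ u ∈ shell T v a,
          ∑ w ∈ ballFinset T v r, F u w)
          (fun n _ => sum_nonneg fun _ _ => sum_nonneg fun u _ => sum_nonneg fun w _ => hF0 u w)
          (self_mem_range_succ r)

end Estimates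

/-! ### The load in terms of the size of the ball -/

section Growth

/-- The size of the ball and the load at its centre, up to constants depending only on the degrees:
with `Q + 1` the largest degree and `k` the number of factors of that degree, the size is of order
`Q ^ r * r ^ (k - 1)` and the load is of order `Q ^ (2 * r) * r ^ (k - 1)`. -/
lemma exists_ball_and_load_bounds {S : Type*} [Fintype S] [DecidableEq S] (q : S → ℕ) (Q : ℕ)
    (hq : ∀ s, 2 ≤ q s) (hqQ : ∀ s, q s ≤ Q) {s₀ : S} (h₀ : q s₀ = Q) :
    ∃ c C : ℝ, 0 < c ∧ 0 < C ∧ ∀ {V : S → Type*} (T : ∀ s, SimpleGraph (V s))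
      [∀ s, (T s).LocallyFinite], (∀ s, (T s).IsTree) →
      (∀ s, (T s).IsRegularOfDegree (q s + 1)) → ∀ (v : ∀ s, V s) (r : ℕ), 1 ≤ r →
        (graphBall (boxProdPi T) v r).Finite ∧
        (Q : ℝ) ^ r ≤ (graphBall (boxProdPi T) v r).ncard ∧
        c * ((Q : ℝ) ^ r * ((r : ℝ) + 1) ^ (#{s | q s = Q} - 1)) ≤
          (graphBall (boxProdPi T) v r).ncard ∧
        (graphBall (boxProdPi T) v r).ncard ≤
          C * ((Q : ℝ) ^ r * ((r : ℝ) + 1) ^ (#{s | q s = Q} - 1)) ∧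
        c * ((Q : ℝ) ^ (2 * r) * ((r : ℝ) + 1) ^ (#{s | q s = Q} - 1)) ≤
          trafficLoad ((boxProdPi T).induce (graphBall (boxProdPi T) v r))
            (graphBallCenter (boxProdPi T) v r) ∧
        trafficLoad ((boxProdPi T).induce (graphBall (boxProdPi T) v r))
            (graphBallCenter (boxProdPi T) v r) ≤
          C * ((Q : ℝ) ^ (2 * r) * ((r : ℝ) + 1) ^ (#{s | q s = Q} - 1)) := by
  have hne : Nonempty S := ⟨s₀⟩
  have hQ : 2 ≤ Q := h₀ ▸ hq s₀
  have hQ0 : Q ≠ 0 := by omega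
  have hQpos : (0 : ℝ) < Q := by exact_mod_cast Nat.pos_of_ne_zero hQ0
  have hρ : ∀ s, 0 ≤ relativeBranching q Q s := relativeBranching_nonneg
  have hρ1 : ∀ s, relativeBranching q Q s ≤ 1 := fun s => by
    rw [relativeBranching, div_le_one hQpos]
    exact_mod_cast hqQ s
  have hρeq : ∀ s, relativeBranching q Q s = 1 ↔ q s = Q := fun s => by
    rw [relativeBranching, div_eq_one_iff_eq hQpos.ne']
    exact_mod_cast Iff.rfl
  have hρ0 : relativeBranching q Q s₀ = 1 := (hρeq s₀).2 h₀
  have hcard : #{s | relativeBranching q Q s = 1} = #{s | q s = Q} := by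
    congr 1
    exact filter_congr fun s _ => hρeq s
  obtain ⟨C, hC, hup⟩ := exists_completeHomogeneous_le hρ hρ1 hρ0
  obtain ⟨c, hc, hlow⟩ := exists_le_completeHomogeneous hρ hρ0
  rw [hcard] at hup hlow
  set e := #{s | q s = Q} - 1
  set K : ℝ := 2 ^ Fintype.card S with hK
  have hK1 : 1 ≤ K := one_le_pow₀ (by norm_num)
  refine ⟨1 / 2 * c, K ^ 4 * C * 4, by positivity, by positivity, ?_⟩
  intro V T _ hT hreg v r hr
  have hball : graphBall (boxProdPi T) v r = (ballFinset T v r : Set (∀ s, V s)) :=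
    Set.ext fun u => (mem_ballFinset hT).symm
  have hncard : (graphBall (boxProdPi T) v r).ncard = #(ballFinset T v r) := by
    rw [hball, Set.ncard_coe_finset]
  have hq1 : ∀ s, 1 ≤ q s := fun s => le_trans one_le_two (hq s)
  have hlow1 := le_card_ballFinset hT hreg hQ0 v r
  have hX : 0 ≤ (Q : ℝ) ^ r * ((r : ℝ) + 1) ^ e := by positivity
  rw [hncard]
  refine ⟨hball ▸ finite_toSet _, ?_, ?_, ?_, ?_, ?_⟩
  · refine le_trans ?_ hlow1
    exact le_mul_of_one_le_right (by positivity) (one_le_completeHomogeneous hρ hρ0 r)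
  · refine le_trans ?_ hlow1
    calc _ ≤ c * ((Q : ℝ) ^ r * ((r : ℝ) + 1) ^ e) := by
          refine mul_le_mul_of_nonneg_right ?_ hX
          linarith
      _ = (Q : ℝ) ^ r * (c * ((r : ℝ) + 1) ^ e) := by ring
      _ ≤ _ := mul_le_mul_of_nonneg_left (hlow r) (by positivity)
  · refine (card_ballFinset_le hT hq1 hreg hQ v hC hup).trans ?_
    refine mul_le_mul_of_nonneg_right ?_ hX
    have h4 : K ≤ K ^ 4 := le_self_pow₀ hK1 (by norm_num)
    have h5 : K * C ≤ K ^ 4 * C := mul_le_mul_of_nonneg_right h4 hC.le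
    have h6 : 0 ≤ K * C := by positivity
    linarith
  · refine le_trans ?_ (le_trafficLoad hT hreg hQ0 v hr)
    calc _ = 1 / 2 * ((Q : ℝ) ^ (2 * r) * (c * ((r : ℝ) + 1) ^ e)) := by ring
      _ ≤ _ := by
        gcongr
        refine le_trans ?_ (hlow (r + r))
        gcongr
        linarith [(Nat.cast_nonneg r : (0 : ℝ) ≤ r)]
  · exact trafficLoad_le hT hq1 hqQ hreg hQ v hC hup

/-- Conversion of the bounds in terms of the radius `r` into bounds in terms of the size `n` of the
ball, whose logarithm is comparable to `r`. -/
lemma exists_bounds_of_radius_bounds {Q : ℕ} (hQ : 2 ≤ Q) (e : ℕ) {c C : ℝ} (hc : 0 < c)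
    (hC : 0 < C) :
    ∃ c₁ c₂ : ℝ, 0 < c₁ ∧ 0 < c₂ ∧ ∀ (r : ℕ) (n L : ℝ), 1 ≤ r → (Q : ℝ) ^ r ≤ n →
      c * ((Q : ℝ) ^ r * ((r : ℝ) + 1) ^ e) ≤ n → n ≤ C * ((Q : ℝ) ^ r * ((r : ℝ) + 1) ^ e) →
      c * ((Q : ℝ) ^ (2 * r) * ((r : ℝ) + 1) ^ e) ≤ L →
      L ≤ C * ((Q : ℝ) ^ (2 * r) * ((r : ℝ) + 1) ^ e) →
      c₁ * (n ^ 2 / Real.logb Q n ^ e) ≤ L ∧ L ≤ c₂ * (n ^ 2 / Real.logb Q n ^ e) := by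
  have hQ1 : (1 : ℝ) < Q := by exact_mod_cast hQ
  have hQpos : (0 : ℝ) < Q := by linarith
  obtain ⟨M, hM⟩ : ∃ M : ℕ, C < (Q : ℝ) ^ M := pow_unbounded_of_one_lt C hQ1
  set D : ℝ := (M : ℝ) + 1 + e with hD
  have hDpos : 0 < D := by positivity
  refine ⟨c / (C ^ 2 * 2 ^ e), C * D ^ e / c ^ 2, by positivity, by positivity, ?_⟩
  intro r n L hr hn0 hn1 hn2 hL1 hL2
  have hr' : (1 : ℝ) ≤ r := by exact_mod_cast hr
  have hnpos : 0 < n := lt_of_lt_of_le (by positivity) hn0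
  set l := Real.logb Q n with hl
  have hl1 : (r : ℝ) ≤ l := by
    rw [hl, Real.le_logb_iff_rpow_le hQ1 hnpos, Real.rpow_natCast]
    exact hn0
  have hl2 : l ≤ D * ((r : ℝ) + 1) := by
    have h1 : ((r : ℝ) + 1) ≤ (Q : ℝ) ^ r := by
      have : r + 1 ≤ Q ^ r := Nat.lt_pow_self hQ
      exact_mod_cast this
    have h2 : n ≤ (Q : ℝ) ^ (M + (r + r * e)) := by
      refine hn2.trans ?_
      rw [pow_add, pow_add, pow_mul]
      gcongr
    have h3 : l ≤ ((M + (r + r * e) : ℕ) : ℝ) := by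
      rw [hl, Real.logb_le_iff_le_rpow hQ1 hnpos, Real.rpow_natCast]
      exact h2
    refine h3.trans ?_
    push_cast
    rw [hD]
    have hM0 : (0 : ℝ) ≤ M := Nat.cast_nonneg M
    have he0 : (0 : ℝ) ≤ e := Nat.cast_nonneg e
    nlinarith
  have hlpos : 0 < l := by linarith
  set X : ℝ := (r : ℝ) + 1 with hX
  have hXpos : 0 < X := by positivity
  have hX2 : X ≤ 2 * l := by linarith
  have hle : 0 < l ^ e := by positivity
  have hXe : X ^ e ≤ 2 ^ e * l ^ e := by
    rw [← mul_pow]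
    exact pow_le_pow_left₀ hXpos.le hX2 e
  have hlD : l ^ e ≤ D ^ e * X ^ e := by
    rw [← mul_pow]
    exact pow_le_pow_left₀ hlpos.le hl2 e
  have hQr : (Q : ℝ) ^ (2 * r) = (Q : ℝ) ^ r * (Q : ℝ) ^ r := by rw [two_mul, pow_add]
  rw [hQr] at hL1 hL2
  set Y : ℝ := (Q : ℝ) ^ r with hY
  have hYpos : 0 < Y := by positivity
  have hXepos : 0 < X ^ e := by positivity
  constructor
  · refine le_trans ?_ hL1
    have h1 : n ^ 2 ≤ C ^ 2 * (Y * Y) * X ^ e * (2 ^ e * l ^ e) := by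
      calc n ^ 2 ≤ (C * (Y * X ^ e)) ^ 2 := pow_le_pow_left₀ hnpos.le hn2 2
        _ = C ^ 2 * (Y * Y) * X ^ e * X ^ e := by ring
        _ ≤ _ := mul_le_mul_of_nonneg_left hXe (by positivity)
    have h2 : n ^ 2 / l ^ e ≤ C ^ 2 * (Y * Y) * X ^ e * 2 ^ e := by
      rw [div_le_iff₀ hle]
      linarith
    calc c / (C ^ 2 * 2 ^ e) * (n ^ 2 / l ^ e) ≤
          c / (C ^ 2 * 2 ^ e) * (C ^ 2 * (Y * Y) * X ^ e * 2 ^ e) :=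
          mul_le_mul_of_nonneg_left h2 (by positivity)
      _ = _ := by field_simp
  · refine hL2.trans ?_
    have h1 : c ^ 2 * (Y * Y) * X ^ e / D ^ e ≤ n ^ 2 / l ^ e := by
      rw [div_le_div_iff₀ (by positivity) hle]
      calc c ^ 2 * (Y * Y) * X ^ e * l ^ e ≤ c ^ 2 * (Y * Y) * X ^ e * (D ^ e * X ^ e) :=
            mul_le_mul_of_nonneg_left hlD (by positivity)
        _ = (c * (Y * X ^ e)) ^ 2 * D ^ e := by ring
        _ ≤ n ^ 2 * D ^ e :=
            mul_le_mul_of_nonneg_right (pow_le_pow_left₀ (by positivity) hn1 2) (by positivity)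
    calc C * (Y * Y * X ^ e) = C * D ^ e / c ^ 2 * (c ^ 2 * (Y * Y) * X ^ e / D ^ e) := by
          field_simp
      _ ≤ _ := mul_le_mul_of_nonneg_left h1 (by positivity)

lemma card_filter_sigma_fst_eq {p : ℕ} (k : Fin p → ℕ) (m : Fin p) :
    #{s : (i : Fin p) × Fin (k i) | s.1 = m} = k m := by
  have : ({s : (i : Fin p) × Fin (k i) | s.1 = m} : Finset _) =
      (univ : Finset (Fin (k m))).map ⟨Sigma.mk m, sigma_mk_injective⟩ := by
    ext ⟨i, j⟩
    simp only [mem_filter, mem_univ, true_and, mem_map, Function.Embedding.coeFn_mk]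
    constructor
    · rintro rfl
      exact ⟨j, rfl⟩
    · rintro ⟨j', h⟩
      exact (congrArg Sigma.fst h).symm
  rw [this, card_map, card_univ, Fintype.card_fin]

end Growth

theorem mainTheorem3 {p : ℕ} (hp : 1 ≤ p) (d k : Fin p → ℕ)
    (hd3 : ∀ i, 3 ≤ d i) (hd : StrictMono d) (hk : ∀ i, 1 ≤ k i) :
    let m : Fin p := ⟨p - 1, Nat.sub_lt hp Nat.one_pos⟩
    ∃ c₁ c₂ : ℝ, 0 < c₁ ∧ 0 < c₂ ∧
      ∀ {V : Fin p → Type*} (T : (i : Fin p) → SimpleGraph (V i))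
        [∀ i, (T i).LocallyFinite],
        (∀ i, (T i).IsTree) → (∀ i, (T i).IsRegularOfDegree (d i)) →
        ∀ (v : (s : (i : Fin p) × Fin (k i)) → V s.1) (r : ℕ), 1 ≤ r →
          let X := prodPow T k
          let B := graphBall X v r
          let n : ℕ := B.ncard
          let L : ℝ := trafficLoad (X.induce B) (graphBallCenter X v r)
          let g : ℝ := (n : ℝ) ^ 2 / (Real.logb ((d m : ℝ) - 1) n) ^ (k m - 1)
          B.Finite ∧ c₁ * g ≤ L ∧ L ≤ c₂ * g := by
  intro m
  have hle : ∀ i, i ≤ m := fun i => by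
    rw [Fin.le_def]
    exact Nat.le_sub_one_of_lt i.2
  have hdm := hd3 m
  have hsub : ((d m - 1 : ℕ) : ℝ) = (d m : ℝ) - 1 := by
    rw [Nat.cast_sub (by omega), Nat.cast_one]
  have hcard : #{s : (i : Fin p) × Fin (k i) | d s.1 - 1 = d m - 1} = k m := by
    rw [← card_filter_sigma_fst_eq k m]
    congr 1
    refine filter_congr fun s _ => ⟨fun h => ?_, fun h => by rw [h]⟩
    have := hd3 s.1
    exact hd.injective (by omega)
  obtain ⟨c, C, hc, hC, hbound⟩ := exists_ball_and_load_bounds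
    (fun s : (i : Fin p) × Fin (k i) => d s.1 - 1) (d m - 1)
    (fun s => by have := hd3 s.1; omega)
    (fun s => Nat.sub_le_sub_right (hd.monotone (hle s.1)) 1)
    (s₀ := ⟨m, ⟨0, hk m⟩⟩) rfl
  obtain ⟨c₁, c₂, hc₁, hc₂, hconv⟩ := exists_bounds_of_radius_bounds (Q := d m - 1) (by omega)
    (k m - 1) hc hC
  refine ⟨c₁, c₂, hc₁, hc₂, ?_⟩
  intro V T _ hT hreg v r hr
  have hreg' : ∀ s : (i : Fin p) × Fin (k i), (T s.1).IsRegularOfDegree (d s.1 - 1 + 1) :=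
    fun s => by
      have := hd3 s.1
      rw [Nat.sub_add_cancel (by omega)]
      exact hreg s.1
  obtain ⟨hfin, h0, h1, h2, h3, h4⟩ :=
    hbound (fun s : (i : Fin p) × Fin (k i) => T s.1) (fun s => hT s.1) hreg' v r hr
  rw [hcard] at h1 h2 h3 h4
  have h5 := hconv r _ _ hr h0 h1 h2 h3 h4
  rw [hsub] at h5
  exact ⟨hfin, h5⟩
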